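/- Let $k$ be an algebraically closed field of characteristic $0$ and let $(R,\mathfrak m)$ be a Noetherian complete local domain of Krull dimension one that is a $k$-algebra with residue field $k$ (via $k\to R\to R/\mathfrak m$). Let $n=\mu(\mathfrak m)$ be the embedding dimension of $R$, let $\overline R$ be the integral closure of $R$ in its fraction field $Q$, let $\mathfrak C=R:_Q\overline R$ be the conductor, and let $x\in\mathfrak m$ generate a minimal reduction of $\mathfrak m$. Let $s=\dim_k\,(\mathfrak C,x)/(x)$ be the reduced type of $R$. Write $R\cong k[[X_1,\dots,X_n]]/I$, and let $\Omega_R$ be the universally finite module of differentials of $R$ over $k$, i.e. the cokernel of the Jacobian matrix of a generating set of $I$, $\Omega_R=R^n/\langle(\partial f/\partial X_1,\dots,\partial f/\partial X_n) : f\in I\rangle$; let $\tau(\Omega_R)$ be its torsion submodule. If $\mathfrak m^4\subseteq(\mathfrak C,x)$ and $n(n-3)\ge 2s$, then $\tau(\Omega_R)\neq 0$. In particular Berger's conjecture holds for $R$: $R$ is regular if and only if $\tau(\Omega_R)=0$. -/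

import Mathlib

open IsLocalRing

/-- The conductor `R :_Q R̄` of a domain `R` in its integral closure `R̄` inside the fraction
field `Q`. It is contained in `R`, and is regarded as an ideal of `R`. -/
noncomputable def conductorIdeal (R : Type*) [CommRing R] [IsDomain R] : Ideal R :=
  ((1 : Submodule R (FractionRing R)) /
    Subalgebra.toSubmodule (integralClosure R (FractionRing R))).comap
      (Algebra.linearMap R (FractionRing R))

/-- `J` is a reduction of `I`: `J ⊆ I` and `J I ^ r = I ^ (r + 1)` for some `r`. -/
def IsReductionOf {R : Type*} [CommRing R] (J I : Ideal R) : Prop :=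
  J ≤ I ∧ ∃ r : ℕ, J * I ^ r = I ^ (r + 1)

/-- `J` is a minimal reduction of `I`: a reduction of `I` that is minimal under inclusion. -/
def IsMinimalReductionOf {R : Type*} [CommRing R] (J I : Ideal R) : Prop :=
  Minimal (fun J' : Ideal R => IsReductionOf J' I) J

/-- The reduced type `dim_k (𝔠, x) / (x)`, where `𝔠` is the conductor of `R`; the quotient
`(𝔠, x) / (x)` is the image of the ideal `(𝔠, x)` in `R / (x)`. -/
noncomputable def reducedType (k R : Type*) [Field k] [CommRing R] [IsDomain R] [Algebra k R]
    (x : R) : ℕ :=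
  Module.finrank k
    ((conductorIdeal R ⊔ Ideal.span {x}).map (Ideal.Quotient.mk (Ideal.span {x})))

/-- The column `(∂f/∂X₁, …, ∂f/∂Xₙ)` of the Jacobian matrix, with entries mapped to `R` along
`Φ : k⟦X₁, …, Xₙ⟧ → R`. -/
noncomputable def jacobianColumn {k R : Type*} [Field k] [CommRing R] [Algebra k R] {n : ℕ}
    (Φ : MvPowerSeries (Fin n) k →ₐ[k] R) (f : MvPowerSeries (Fin n) k) : Fin n → R :=
  fun i => Φ (MvPowerSeries.pderiv k i f)

/-- The universally finite module of differentials of `R = k⟦X₁, …, Xₙ⟧ / I`, where `I` is the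
kernel of the surjection `Φ`: the cokernel of the Jacobian matrix of `I`, that is, `Rⁿ` modulo
the Jacobian columns of the elements of `I`. (If `f₁, …, fₘ` generate `I`, the columns of
`f₁, …, fₘ` span the same submodule, by the product rule.) -/
abbrev UniversallyFiniteDifferentials {k R : Type*} [Field k] [CommRing R] [Algebra k R] {n : ℕ}
    (Φ : MvPowerSeries (Fin n) k →ₐ[k] R) : Type _ :=
  (Fin n → R) ⧸ Submodule.span R (jacobianColumn Φ '' (RingHom.ker Φ : Set (MvPowerSeries (Fin n) k)))

/-- A complete Noetherian local `k`-algebra with residue field `k` is a quotient of a power series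
ring over `k` in as many variables as its embedding dimension, so the presentations over which
`UniversallyFiniteDifferentials` is defined exist. -/
theorem exists_surjective_mvPowerSeries (k R : Type*) [Field k] [CommRing R] [IsLocalRing R]
    [IsNoetherianRing R] [Algebra k R] [IsAdicComplete (maximalIdeal R) R]
    (hres : Function.Bijective (algebraMap k (ResidueField R))) :
    ∃ Φ : MvPowerSeries (Fin (maximalIdeal R).spanFinrank) k →ₐ[k] R, Function.Surjective Φ := by
  set n := (maximalIdeal R).spanFinrank with hn
  set I := maximalIdeal R with hI
  obtain ⟨x, hx⟩ : ∃ x : Fin n → R, Ideal.span (Set.range x) = I := by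
    have hfg : I.FG := IsNoetherian.noetherian I
    have hg := Submodule.FG.generators_ncard hfg
    have hfin : I.generators.Finite := Submodule.FG.finite_generators hfg
    have : Nat.card I.generators = n := hg
    have := hfin.to_subtype
    let e : I.generators ≃ Fin n := (Finite.equivFin _).trans (finCongr ‹_›)
    refine ⟨fun i => (e.symm i : R), ?_⟩
    have : Set.range (fun i => (e.symm i : R)) = I.generators := by
      rw [show (fun i => (e.symm i : R)) = Subtype.val ∘ e.symm from rfl, e.symm.surjective.range_comp]
      simp
    rw [this]
    exact Submodule.span_generators I
  have hxI : ∀ i, x i ∈ I := fun i => hx ▸ Ideal.subset_span ⟨i, rfl⟩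
  have step : ∀ j : ℕ, ∀ r ∈ I ^ j, ∃ p : MvPolynomial (Fin n) k, p.IsHomogeneous j ∧
      r - MvPolynomial.aeval x p ∈ I ^ (j + 1) := by
    have scal : ∀ r : R, ∃ c : k, r - algebraMap k R c ∈ I := by
      intro r
      obtain ⟨c, hc⟩ := hres.2 (residue R r)
      refine ⟨c, ?_⟩
      rw [hI, ← residue_eq_zero_iff, map_sub, ← hc]
      exact sub_self _
    intro j
    induction j with
    | zero =>
      intro r _
      obtain ⟨c, hc⟩ := scal r
      exact ⟨MvPolynomial.C c, MvPolynomial.isHomogeneous_C _ _, by simpa using hc⟩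
    | succ j ih =>
      intro r hr
      rw [pow_succ] at hr
      refine Submodule.mul_induction_on hr ?_ ?_
      · intro a ha b hb
        obtain ⟨p, hp, hpa⟩ := ih a ha
        rw [← hx] at hb
        obtain ⟨c, rfl⟩ := Ideal.mem_span_range_iff_exists_fun.1 hb
        choose l hl using fun i => scal (c i)
        refine ⟨p * ∑ i, MvPolynomial.C (l i) * MvPolynomial.X i, hp.mul ?_, ?_⟩
        · refine MvPolynomial.IsHomogeneous.sum _ _ _ fun i _ => ?_
          simpa using (MvPolynomial.isHomogeneous_C _ _).mul (MvPolynomial.isHomogeneous_X k i)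
        · have h2 : ∑ i, c i * x i - ∑ i, algebraMap k R (l i) * x i ∈ I ^ 2 := by
            rw [← Finset.sum_sub_distrib]
            refine Ideal.sum_mem _ fun i _ => ?_
            rw [← sub_mul, pow_two]
            exact Ideal.mul_mem_mul (hl i) (hxI i)
          have h1 : ∑ i, c i * x i ∈ I := Ideal.sum_mem _ fun i _ => Ideal.mul_mem_left _ _ (hxI i)
          have hpj : MvPolynomial.aeval x p ∈ I ^ j := by
            have := Ideal.sub_mem _ ha (Ideal.pow_le_pow_right (Nat.le_succ j) hpa)
            simpa using this
          have e1 := Ideal.mul_mem_mul hpa h1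
          have e2 := Ideal.mul_mem_mul hpj h2
          rw [← pow_succ] at e1
          rw [← pow_add] at e2
          have := Ideal.add_mem _ e1 e2
          convert this using 1
          simp only [map_mul, map_sum, MvPolynomial.aeval_C, MvPolynomial.aeval_X]
          ring
      · rintro a b ⟨p, hp, hpa⟩ ⟨q, hq, hqb⟩
        refine ⟨p + q, hp.add hq, ?_⟩
        convert Ideal.add_mem _ hpa hqb using 1
        simp only [map_add]; ring
  let : UniformSpace k := ⊥
  have : DiscreteTopology k := ⟨rfl⟩
  let : TopologicalSpace R := I.adicTopology
  have hadic : IsAdic I := rfl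
  have : IsTopologicalRing R := (I.ringFilterBasis).isTopologicalRing
  let : UniformSpace R := IsTopologicalAddGroup.rightUniformSpace R
  have : IsUniformAddGroup R := isUniformAddGroup_of_addCommGroup
  have : IsLinearTopology R R := I.isLinearTopology
  obtain ⟨h1, h2⟩ := hadic.isAdicComplete_iff.1 ‹_›
  have : ContinuousSMul k R := ⟨by
    rw [continuous_prod_of_discrete_left]
    intro c
    simp_rw [Algebra.smul_def]
    exact continuous_const.mul continuous_id⟩
  have ha : MvPowerSeries.HasEval x := by
    refine ⟨fun i => ?_, by simp [Filter.cofinite_eq_bot]⟩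
    refine hadic.hasBasis_nhds_zero.tendsto_right_iff.2 fun N _ => ?_
    filter_upwards [Filter.eventually_ge_atTop N] with m hm
    exact Ideal.pow_le_pow_right hm (Ideal.pow_mem_pow (hxI i) m)
  refine ⟨MvPowerSeries.aeval ha, fun r => ?_⟩
  choose! p hp hpr using step
  let s : ℕ → R := fun j => Nat.rec r (fun j t => t - MvPolynomial.aeval x (p j t)) j
  have hs : ∀ j, s j ∈ I ^ j := by
    intro j
    induction j with
    | zero => simp
    | succ j ih => exact hpr j _ ih
  let f : MvPowerSeries (Fin n) k := fun d => (p d.degree (s d.degree)).coeff d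
  let F : ℕ → MvPolynomial (Fin n) k := fun N => ∑ j ∈ Finset.range N, p j (s j)
  have hF : ∀ N, MvPolynomial.aeval x (F N) = r - s N := by
    intro N
    induction N with
    | zero => simp [F, s]
    | succ N ih =>
      have : s (N + 1) = s N - MvPolynomial.aeval x (p N (s N)) := rfl
      simp only [F, Finset.sum_range_succ, map_add] at ih ⊢
      rw [ih, this]; ring
  open scoped MvPowerSeries.WithPiTopology in
  have hlim : Filter.Tendsto (fun N => (F N : MvPowerSeries (Fin n) k)) Filter.atTop (nhds f) := by
    rw [MvPowerSeries.WithPiTopology.tendsto_iff_coeff_tendsto]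
    intro d
    refine tendsto_const_nhds.congr' ?_
    filter_upwards [Filter.eventually_gt_atTop d.degree] with N hN
    rw [MvPolynomial.coeff_coe, MvPolynomial.coeff_sum]
    rw [Finset.sum_eq_single d.degree]
    · rfl
    · intro b _ hb
      exact (hp b _ (hs b)).coeff_eq_zero (Ne.symm hb)
    · intro h; simp at h; omega
  have t1 := ((MvPowerSeries.continuous_aeval ha).tendsto f).comp hlim
  have t2 : Filter.Tendsto (fun N => r - s N) Filter.atTop (nhds r) := by
    refine (hadic.hasBasis_nhds r).tendsto_right_iff.2 fun N _ => ?_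
    filter_upwards [Filter.eventually_ge_atTop N] with m hm
    refine ⟨- s m, neg_mem (Ideal.pow_le_pow_right hm (hs m)), ?_⟩
    simp [sub_eq_add_neg]
  refine ⟨f, tendsto_nhds_unique t1 (t2.congr fun N => ?_)⟩
  simp [hF]

/-! Suppose Ω is torsion-free, put Y = Ω / R dx, and let 𝔟 = (ℭ, x); all that matters about 𝔟 is
that it contains x and 𝔪 ^ 4. The contradiction comes from bounding dim Y / xY from both sides.

Upper bound. A derivation into a finitely generated torsion-free module that kills x is zero,
because R is finite over its constants (`Derivation.eq_zero_of_apply_eq_zero`). Hence Y is torsion,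
so of finite length, and multiplication by x on Y has kernel and cokernel of equal dimension. An
element of the kernel is the class of some m with x m = r dx, and m ↦ r embeds the kernel in R /
(x). The image does not meet the line of constants, because dx ∉ xΩ (`derivation_ne_smul`). So dim Y
/ xY ≤ dim R / (x) - 1 (`finrank_coker_smul_lt`).

Lower bound. Note Y / xY = Ω / (xΩ + R dx). The exterior derivative, reduced modulo 𝔪 and modulo x,
maps it onto ⋀² of the (n - 1)-dimensional space 𝔪 / (𝔪 ^ 2 + (x)) and kills exact forms
(`exists_exteriorDerivative`, `exists_exteriorDerivative_quotient`). The exact forms contribute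
separately: if dr ∈ xΩ + R dx, then r is killed by the universal derivation of R / 𝔟, hence is
constant there by an Euler operator argument, which is where 𝔪 ^ 4 ⊆ 𝔟 enters
(`exists_eq_algebraMap_of_D_eq_zero`). So dim Y / xY ≥ (n - 1 choose 2) + dim R / 𝔟 - 1
(`choose_add_finrank_le`).

Together (n - 1 choose 2) ≤ dim 𝔟 / (x) = s, so n(n - 3) + 2 = (n - 1)(n - 2) ≤ 2s, against n(n - 3)
≥ 2s. -/

open IsLocalRing

/-! ### Minimal generators of the maximal ideal -/

/-- If `y₁, …, yₙ` generate the maximal ideal and `n` is the embedding dimension, then the `yᵢ` are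
linearly independent modulo the square of the maximal ideal. -/
theorem eq_zero_of_sum_mem_maximalIdeal_sq {k R : Type*} [Field k] [CommRing R] [IsLocalRing R]
    [IsNoetherianRing R] [Algebra k R] {n : ℕ} (hn : (maximalIdeal R).spanFinrank = n)
    {y : Fin n → R} (hy : Ideal.span (Set.range y) = maximalIdeal R) {c : Fin n → k}
    (hc : ∑ i, algebraMap k R (c i) * y i ∈ maximalIdeal R ^ 2) : c = 0 := by
  by_contra hne
  obtain ⟨j, hj⟩ := Function.ne_iff.1 hne
  have hj' : c j ≠ 0 := hj
  -- Since `c j` is invertible, `y j` lies in the span of the other generators plus the square; by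
  -- Nakayama n - 1 generators would suffice.
  have hle : maximalIdeal R ≤ Ideal.span (y '' {j}ᶜ) := by
    refine Submodule.le_of_le_smul_of_le_jacobson_bot (I := maximalIdeal R)
      (IsNoetherian.noetherian _) (IsLocalRing.maximalIdeal_le_jacobson _) ?_
    nth_rw 1 [← hy]
    rw [Ideal.span_le]
    rintro _ ⟨i, rfl⟩
    by_cases hij : i = j
    · subst hij
      rw [smul_eq_mul, ← pow_two]
      have h1 : algebraMap k R (c i) * y i ∈
          Ideal.span (y '' {i}ᶜ) ⊔ maximalIdeal R ^ 2 := by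
        have : algebraMap k R (c i) * y i = -∑ l ∈ Finset.univ.erase i, algebraMap k R (c l) * y l
            + ∑ l, algebraMap k R (c l) * y l := by
          rw [← Finset.add_sum_erase _ _ (Finset.mem_univ i)]; ring
        rw [this]
        refine Ideal.add_mem _ (neg_mem (Ideal.sum_mem _ fun l hl => ?_)) (Ideal.mem_sup_right hc)
        exact Ideal.mem_sup_left (Ideal.mul_mem_left _ _
          (Ideal.subset_span ⟨l, Finset.ne_of_mem_erase hl, rfl⟩))
      have : y i = algebraMap k R (c i)⁻¹ * (algebraMap k R (c i) * y i) := by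
        rw [← mul_assoc, ← map_mul, inv_mul_cancel₀ hj', map_one, one_mul]
      rw [this]
      exact Ideal.mul_mem_left _ _ h1
    · exact Ideal.mem_sup_left (Ideal.subset_span ⟨i, hij, rfl⟩)
  have heq : maximalIdeal R = Ideal.span (y '' {j}ᶜ) :=
    le_antisymm hle (by rw [← hy]; exact Ideal.span_mono (Set.image_subset_range _ _))
  have h1 : (maximalIdeal R).spanFinrank ≤ (y '' {j}ᶜ).ncard := by
    rw [heq]
    exact Submodule.spanFinrank_span_le_ncard_of_finite (Set.toFinite _)
  have h2 : (y '' {j}ᶜ).ncard ≤ ({j}ᶜ : Set (Fin n)).ncard := Set.ncard_image_le (Set.toFinite _)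
  have h3 : ({j}ᶜ : Set (Fin n)).ncard < n := by
    rw [Set.ncard_compl, Set.ncard_singleton, Nat.card_eq_fintype_card, Fintype.card_fin]
    have := j.pos
    omega
  omega

/-! ### The Euler operator on polynomials -/

namespace MvPolynomial

variable {k : Type*} [Field k] {N : ℕ}

theorem coeff_X_mul_pderiv (i : Fin N) (p : MvPolynomial (Fin N) k) (m : Fin N →₀ ℕ) :
    coeff m (X i * pderiv i p) = m i * coeff m p := by
  rw [coeff_X_mul']
  split_ifs with h
  · rw [coeff_pderiv]
    have hle : Finsupp.single i 1 ≤ m := by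
      rw [Finsupp.single_le_iff]
      exact Nat.one_le_iff_ne_zero.2 (Finsupp.mem_support_iff.1 h)
    have h1 : (1 : ℕ) ≤ m i := Finsupp.single_le_iff.1 hle
    rw [tsub_add_cancel_of_le hle]
    simp only [Finsupp.tsub_apply, Finsupp.single_eq_same]
    rw [Nat.cast_sub h1]
    push_cast
    ring
  · simp [Finsupp.notMem_support_iff.1 h]

theorem coeff_sum_X_mul_pderiv (p : MvPolynomial (Fin N) k) (m : Fin N →₀ ℕ) :
    coeff m (∑ i, X i * pderiv i p) = m.degree * coeff m p := by
  rw [coeff_sum, Finsupp.degree_eq_sum, Nat.cast_sum, Finset.sum_mul]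
  exact Finset.sum_congr rfl fun i _ => coeff_X_mul_pderiv i p m

/-- If all partial derivatives of `p` lie in an ideal between the fourth and the second power of the
ideal of the variables, then `p` lies in that ideal up to a constant. -/
theorem sub_C_mem_of_pderiv_mem [CharZero k] {b : Ideal (MvPolynomial (Fin N) k)}
    (h4 : idealOfVars (Fin N) k ^ 4 ≤ b) (h2 : b ≤ idealOfVars (Fin N) k ^ 2)
    {p : MvPolynomial (Fin N) k} (hp : ∀ i, pderiv i p ∈ b) : p - C (coeff 0 p) ∈ b := by
  -- The partials have order at least 2, so in characteristic zero `p` has no terms of degree 1 or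
  -- 2.
  have hlow : ∀ m : Fin N →₀ ℕ, m ≠ 0 → m.degree < 3 → coeff m p = 0 := by
    intro m hm hdeg
    obtain ⟨i, hi⟩ := Finsupp.ne_iff.1 hm
    have hle : Finsupp.single i 1 ≤ m := Finsupp.single_le_iff.2 (Nat.one_le_iff_ne_zero.2 hi)
    have hd : m.degree = (m - Finsupp.single i 1).degree + 1 := by
      conv_lhs => rw [← tsub_add_cancel_of_le hle]
      rw [map_add, Finsupp.degree_single]
    have := (mem_pow_idealOfVars_iff' 2 _).1 (h2 (hp i)) (m - Finsupp.single i 1) (by omega)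
    rw [coeff_pderiv, tsub_add_cancel_of_le hle] at this
    rcases mul_eq_zero.1 this with h | h
    · exact h
    · exact absurd h (Nat.cast_add_one_ne_zero _)
  have hE : ∑ i, X i * pderiv i p ∈ b := Ideal.sum_mem _ fun i _ => Ideal.mul_mem_left _ _ (hp i)
  -- Below degree 4 only the constant and cubic terms of `p` survive, and the Euler operator
  -- multiplies cubic terms by 3; everything else lies in the fourth power.
  have hdiff : ∑ i, X i * pderiv i p - C 3 * (p - C (coeff 0 p)) ∈ b := by
    refine h4 ((mem_pow_idealOfVars_iff' 4 _).2 fun m hm => ?_)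
    rw [coeff_sub, coeff_sum_X_mul_pderiv, coeff_C_mul, coeff_sub, coeff_C]
    by_cases h0 : m = 0
    · subst h0; simp
    · rw [if_neg (Ne.symm h0)]
      rcases Nat.lt_or_ge m.degree 3 with h | h
      · simp [hlow m h0 h]
      · have : m.degree = 3 := by omega
        rw [this]; push_cast; ring
  have h3 : C 3 * (p - C (coeff 0 p)) ∈ b := by
    have := Ideal.sub_mem _ hE hdiff
    simpa using this
  have : p - C (coeff 0 p) = C (3 : k)⁻¹ * (C 3 * (p - C (coeff 0 p))) := by
    rw [← mul_assoc, ← C_mul, inv_mul_cancel₀ (by norm_num), C_1, one_mul]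
  rw [this]
  exact Ideal.mul_mem_left _ _ h3

end MvPolynomial

theorem exists_fin_span_range_eq_maximalIdeal {R : Type*} [CommRing R] [IsLocalRing R]
    [IsNoetherianRing R] {n : ℕ} (hn : (maximalIdeal R).spanFinrank = n) :
    ∃ y : Fin n → R, Ideal.span (Set.range y) = maximalIdeal R := by
  have hfg : (maximalIdeal R).FG := IsNoetherian.noetherian _
  have := (Submodule.FG.finite_generators hfg).to_subtype
  let e : (maximalIdeal R).generators ≃ Fin n :=
    (Finite.equivFin _).trans (finCongr ((Submodule.FG.generators_ncard hfg).trans hn))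
  refine ⟨fun i => (e.symm i : R), ?_⟩
  have : Set.range (fun i => (e.symm i : R)) = (maximalIdeal R).generators := by
    rw [show (fun i => (e.symm i : R)) = Subtype.val ∘ e.symm from rfl,
      e.symm.surjective.range_comp]
    simp
  rw [this]
  exact Submodule.span_generators _

theorem MvPolynomial.sub_sum_mem_idealOfVars_sq {k : Type*} [Field k] {N : ℕ}
    (f : MvPolynomial (Fin N) k) :
    f - C (coeff 0 f) - ∑ i, C (coeff (Finsupp.single i 1) f) * X i ∈
      idealOfVars (Fin N) k ^ 2 := by
  classical
  refine (mem_pow_idealOfVars_iff' 2 _).2 fun m hm => ?_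
  rw [coeff_sub, coeff_sub, coeff_C, coeff_sum]
  simp only [coeff_C_mul, coeff_X]
  rcases Nat.lt_or_ge m.degree 1 with h | h
  · have : m = 0 := (Finsupp.degree_eq_zero_iff m).1 (by omega)
    subst this
    simp
  · have hm0 : m ≠ 0 := by rintro rfl; simp at h
    obtain ⟨i, hi⟩ := Finsupp.ne_iff.1 hm0
    have hle : Finsupp.single i 1 ≤ m := Finsupp.single_le_iff.2 (Nat.one_le_iff_ne_zero.2 hi)
    obtain ⟨l, rfl⟩ := exists_add_of_le hle
    rw [map_add, Finsupp.degree_single] at hm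
    obtain rfl : l = 0 := (Finsupp.degree_eq_zero_iff l).1 (by omega)
    rw [add_zero]
    rw [Finset.sum_eq_single i]
    · simp [eq_comm (a := (0 : Fin N →₀ ℕ))]
    · intro j _ hj
      rw [if_neg, mul_zero]
      intro h
      exact hj (Finsupp.single_left_injective one_ne_zero h)
    · simp

theorem constant_eq_zero_of_mem_maximalIdeal {k R : Type*} [Field k] [CommRing R] [IsLocalRing R]
    [Algebra k R] {c : k} (hc : algebraMap k R c ∈ maximalIdeal R) : c = 0 := by
  by_contra h
  exact (mem_maximalIdeal _).1 hc ((Ne.isUnit h).map (algebraMap k R))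

/-! ### Constants of the universal derivation when `𝔪 ^ 4 = 0` -/

section Artinian

variable {k B : Type*} [Field k] [CommRing B] [IsLocalRing B] [Algebra k B]

theorem aeval_surjective_of_pow_eq_bot {N : ℕ} {y : Fin N → B}
    (hy : Ideal.span (Set.range y) = maximalIdeal B)
    (hres : ∀ b : B, ∃ c : k, b - algebraMap k B c ∈ maximalIdeal B)
    {j : ℕ} (hj : maximalIdeal B ^ j = ⊥) :
    Function.Surjective (MvPolynomial.aeval (R := k) y) := by
  have happrox : ∀ (j : ℕ) (b : B), ∃ p, b - MvPolynomial.aeval (R := k) y p ∈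
      maximalIdeal B ^ j := by
    intro j
    induction j with
    | zero => intro b; exact ⟨0, by simp⟩
    | succ j ih =>
      intro b
      obtain ⟨c, hc⟩ := hres b
      rw [← hy] at hc
      obtain ⟨a, ha⟩ := Ideal.mem_span_range_iff_exists_fun.1 hc
      choose p hp using fun i => ih (a i)
      refine ⟨MvPolynomial.C c + ∑ i, p i * MvPolynomial.X i, ?_⟩
      have : b - MvPolynomial.aeval y (MvPolynomial.C c + ∑ i, p i * MvPolynomial.X i) =
          ∑ i, (a i - MvPolynomial.aeval y (p i)) * y i := by
        simp only [map_add, map_sum, map_mul, MvPolynomial.aeval_X, MvPolynomial.aeval_C, sub_mul,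
          Finset.sum_sub_distrib, ha]
        ring
      rw [this, pow_succ]
      exact Ideal.sum_mem _ fun i _ => Ideal.mul_mem_mul (hp i)
        (hy ▸ Ideal.subset_span ⟨i, rfl⟩)
  intro b
  obtain ⟨p, hp⟩ := happrox j b
  rw [hj, Ideal.mem_bot, sub_eq_zero] at hp
  exact ⟨p, hp.symm⟩

theorem map_idealOfVars_le {N : ℕ} {y : Fin N → B} (hy : ∀ i, y i ∈ maximalIdeal B) (j : ℕ)
    {f : MvPolynomial (Fin N) k} (hf : f ∈ MvPolynomial.idealOfVars (Fin N) k ^ j) :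
    MvPolynomial.aeval y f ∈ maximalIdeal B ^ j := by
  have h1 : (MvPolynomial.idealOfVars (Fin N) k).map (MvPolynomial.aeval (R := k) y) ≤
      maximalIdeal B := by
    rw [MvPolynomial.idealOfVars, Ideal.map_span, Ideal.span_le]
    rintro _ ⟨_, ⟨i, rfl⟩, rfl⟩
    simpa using hy i
  refine Ideal.pow_right_mono h1 j ?_
  rw [← Ideal.map_pow]
  exact Ideal.mem_map_of_mem _ hf

/-- The linear part of a relation would be a linear dependence among minimal generators modulo the
square of the maximal ideal. -/
theorem ker_aeval_le_idealOfVars_sq [IsNoetherianRing B] {N : ℕ}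
    (hN : (maximalIdeal B).spanFinrank = N) {y : Fin N → B}
    (hy : Ideal.span (Set.range y) = maximalIdeal B) :
    RingHom.ker (MvPolynomial.aeval (R := k) y) ≤ MvPolynomial.idealOfVars (Fin N) k ^ 2 := by
  intro f hf
  have hym : ∀ i, y i ∈ maximalIdeal B := fun i => hy ▸ Ideal.subset_span ⟨i, rfl⟩
  have h := map_idealOfVars_le hym 2 (MvPolynomial.sub_sum_mem_idealOfVars_sq f)
  have hf0 : MvPolynomial.aeval y f = 0 := hf
  simp only [map_sub, map_sum, map_mul, MvPolynomial.aeval_X, MvPolynomial.aeval_C, hf0] at h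
  have hsum : ∑ i, algebraMap k B (f.coeff (Finsupp.single i 1)) * y i ∈ maximalIdeal B :=
    Ideal.sum_mem _ fun i _ => Ideal.mul_mem_left _ _ (hym i)
  have h0 : f.coeff 0 = 0 := by
    refine constant_eq_zero_of_mem_maximalIdeal (R := B) ?_
    have := Ideal.add_mem _ (Ideal.pow_le_self two_ne_zero h) hsum
    rw [sub_add_cancel, zero_sub] at this
    exact neg_mem_iff.1 this
  have hc := eq_zero_of_sum_mem_maximalIdeal_sq hN hy
    (c := fun i => f.coeff (Finsupp.single i 1)) (by
      rw [h0, map_zero, sub_zero, zero_sub] at h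
      exact neg_mem_iff.1 h)
  have := MvPolynomial.sub_sum_mem_idealOfVars_sq f
  simpa [h0, fun i => congrFun hc i] using this

open TensorProduct in
/-- The universal derivation of a local `k`-algebra with residue field `k` and `𝔪 ^ 4 = 0` kills
only the constants. -/
theorem exists_eq_algebraMap_of_D_eq_zero [CharZero k] [IsNoetherianRing B]
    (hres : ∀ b : B, ∃ c : k, b - algebraMap k B c ∈ maximalIdeal B)
    (h4 : maximalIdeal B ^ 4 = ⊥) {b : B} (hb : KaehlerDifferential.D k B b = 0) :
    ∃ c : k, b = algebraMap k B c := by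
  obtain ⟨N, hN⟩ : ∃ N, (maximalIdeal B).spanFinrank = N := ⟨_, rfl⟩
  obtain ⟨y, hy⟩ := exists_fin_span_range_eq_maximalIdeal hN
  have hym : ∀ i, y i ∈ maximalIdeal B := fun i => hy ▸ Ideal.subset_span ⟨i, rfl⟩
  have hsurj := aeval_surjective_of_pow_eq_bot (k := k) hy hres h4
  let S := MvPolynomial (Fin N) k
  let _ : Algebra S B := (MvPolynomial.aeval (R := k) y).toRingHom.toAlgebra
  have hS : ∀ p : S, algebraMap S B p = MvPolynomial.aeval y p := fun _ => rfl
  have : IsScalarTower k S B := IsScalarTower.of_algebraMap_eq fun c => by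
    rw [hS, MvPolynomial.algebraMap_eq, MvPolynomial.aeval_C]
  obtain ⟨p, rfl⟩ := hsurj b
  have hz : KaehlerDifferential.mapBaseChange k S B (1 ⊗ₜ KaehlerDifferential.D k S p) = 0 := by
    rw [KaehlerDifferential.mapBaseChange_tmul, KaehlerDifferential.map_D, one_smul]
    exact hb
  -- By the conormal sequence, `D p` agrees after base change to `B` with `D f` for some `f` in the
  -- kernel; so all partials of `p - f` lie in the kernel, and `p - f` still represents `b`.
  obtain ⟨z, hz⟩ :=
    (KaehlerDifferential.exact_kerCotangentToTensor_mapBaseChange k S B hsurj _).1 hz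
  obtain ⟨⟨f, hf⟩, rfl⟩ := Ideal.toCotangent_surjective _ z
  rw [KaehlerDifferential.kerCotangentToTensor_toCotangent] at hz
  have hfk : MvPolynomial.aeval y f = 0 := hf
  have hpd : ∀ i, MvPolynomial.pderiv i (p - f) ∈ RingHom.ker (MvPolynomial.aeval (R := k) y) := by
    intro i
    let L : B ⊗[S] Ω[S⁄k] →ₗ[S] B := TensorProduct.lift
      ((LinearMap.lsmul S B).flip.compl₂
        ((KaehlerDifferential.mvPolynomialBasis k (Fin N)).coord i))
    have hL : ∀ q : S, L (1 ⊗ₜ KaehlerDifferential.D k S q) =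
        MvPolynomial.aeval y (MvPolynomial.pderiv i q) := by
      intro q
      have hq : (KaehlerDifferential.mvPolynomialBasis k (Fin N)).coord i
          (KaehlerDifferential.D k S q) = MvPolynomial.pderiv i q :=
        KaehlerDifferential.mvPolynomialBasis_repr_apply ..
      simp only [L, TensorProduct.lift.tmul, LinearMap.compl₂_apply, LinearMap.flip_apply,
        LinearMap.lsmul_apply, Algebra.smul_def, mul_one, hq]
      rfl
    have := congrArg L hz
    rw [hL, hL] at this
    rw [RingHom.mem_ker, map_sub, map_sub, this, sub_self]
  have hmem := MvPolynomial.sub_C_mem_of_pderiv_mem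
    (fun q hq => by
      have := map_idealOfVars_le hym 4 hq
      rwa [h4] at this)
    (ker_aeval_le_idealOfVars_sq hN hy) hpd
  refine ⟨(p - f).coeff 0, ?_⟩
  rw [RingHom.mem_ker, map_sub, map_sub, hfk, MvPolynomial.aeval_C, sub_zero, sub_eq_zero] at hmem
  exact hmem

end Artinian

/-! ### Derivations killing `x` and their constants -/

section Derivation

variable {k R V : Type*} [CommRing k] [CommRing R] [Algebra k R] [AddCommGroup V] [Module k V]
  [Module R V]

/-- By Leibniz a derivation lowers the adic order by at most one; this is the continuity used to
pass to limits. -/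
theorem Derivation.apply_mem_pow_smul_top (δ : Derivation k R V) (I : Ideal R) (j : ℕ) {r : R}
    (hr : r ∈ I ^ (j + 1)) : δ r ∈ I ^ j • (⊤ : Submodule R V) := by
  induction j generalizing r with
  | zero => simp
  | succ j ih =>
    rw [pow_succ] at hr
    refine Submodule.mul_induction_on hr ?_ ?_
    · intro a ha b hb
      rw [Derivation.leibniz]
      refine Submodule.add_mem _ (Submodule.smul_mem_smul ha trivial) ?_
      rw [pow_succ', mul_smul]
      exact Submodule.smul_mem_smul hb (ih ha)
    · intro a b ha hb
      rw [map_add]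
      exact Submodule.add_mem _ ha hb

/-- The subring of constants of a derivation. -/
def Derivation.constants (δ : Derivation k R V) : Subring R where
  carrier := {r | δ r = 0}
  mul_mem' {a b} ha hb := by
    have ha' : δ a = 0 := ha
    have hb' : δ b = 0 := hb
    change δ (a * b) = 0
    rw [Derivation.leibniz, ha', hb', smul_zero, smul_zero, add_zero]
  one_mem' := δ.map_one_eq_zero
  add_mem' {a b} ha hb := by
    have ha' : δ a = 0 := ha
    have hb' : δ b = 0 := hb
    change δ (a + b) = 0
    rw [map_add, ha', hb', add_zero]
  zero_mem' := map_zero δ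
  neg_mem' {a} ha := by
    have ha' : δ a = 0 := ha
    change δ (-a) = 0
    rw [map_neg, ha', neg_zero]

theorem Derivation.apply_aeval_constants (δ : Derivation k R V) (r : R)
    (p : Polynomial δ.constants) :
    δ (Polynomial.aeval r p) = Polynomial.aeval r p.derivative • δ r := by
  induction p using Polynomial.induction_on' with
  | add p q hp hq => simp only [map_add, add_smul, hp, hq]
  | monomial j a =>
    have ha : δ (algebraMap δ.constants R a) = 0 := a.2
    simp only [Polynomial.aeval_monomial, Polynomial.derivative_monomial, Derivation.leibniz, ha,
      Derivation.leibniz_pow, smul_zero, add_zero, map_mul, mul_smul]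
    simp only [← Nat.cast_smul_eq_nsmul R, ← mul_smul]
    congr 1

/-- A derivation into a torsion-free module over a domain of characteristic zero is zero if the ring
is integral over its constants. -/
theorem Derivation.eq_zero_of_isIntegral_constants [IsDomain R] [CharZero R]
    [Module.IsTorsionFree R V] (δ : Derivation k R V)
    (hconst : ∀ r : R, IsIntegral δ.constants r) (r : R) : δ r = 0 := by
  classical
  -- Take a nonzero annihilating polynomial of least degree: its derivative cannot vanish at `r`,
  -- while the chain rule gives `p'(r) • δ r = 0`.
  have hex : ∃ j : ℕ, ∃ p : Polynomial δ.constants, p ≠ 0 ∧ Polynomial.aeval r p = 0 ∧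
      p.natDegree = j := by
    obtain ⟨p, hp, hr⟩ := hconst r
    exact ⟨_, p, hp.ne_zero, hr, rfl⟩
  obtain ⟨p, hp0, hpr, hpd⟩ := Nat.find_spec hex
  have hdeg : p.natDegree ≠ 0 := by
    intro h
    obtain ⟨c, rfl⟩ := Polynomial.natDegree_eq_zero.1 h
    rw [Polynomial.aeval_C] at hpr
    apply hp0
    rw [Subtype.ext (a1 := c) (a2 := 0) hpr, Polynomial.C_0]
  have hder : p.derivative ≠ 0 := by
    intro h
    exact hdeg (Polynomial.derivative_eq_zero.1 h)
  have hne : Polynomial.aeval r p.derivative ≠ 0 := by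
    intro h
    refine Nat.find_min hex (m := p.derivative.natDegree) ?_ ⟨_, hder, h, rfl⟩
    rw [← hpd]
    exact Polynomial.natDegree_derivative_lt hdeg
  have := δ.apply_aeval_constants r p
  rw [hpr, map_zero] at this
  exact (smul_eq_zero.1 this.symm).resolve_left hne

end Derivation

/-- If the `b i` span `R / (x)` over `k` and `R` is complete, then they generate `R` over the
subring of constants of every derivation killing `x`. -/
theorem exists_eq_sum_constants_mul {k R V : Type*} [Field k] [CommRing R] [IsLocalRing R]
    [IsNoetherianRing R] [Algebra k R] [IsAdicComplete (maximalIdeal R) R]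
    [AddCommGroup V] [Module k V] [Module R V] [IsScalarTower k R V] [Module.Finite R V]
    (δ : Derivation k R V) {x : R} (hx : x ∈ maximalIdeal R) (hδ : δ x = 0)
    {e : ℕ} {b : Fin e → R} (hb : ∀ r : R, ∃ c : Fin e → k, ∃ r', r = ∑ i, c i • b i + x * r')
    (r : R) : ∃ c : Fin e → R, (∀ i, δ (c i) = 0) ∧ r = ∑ i, c i * b i := by
  choose c q hcq using hb
  -- Iterated division by `x`: `s j` is the j-th remainder, and `C i N` truncates the power series
  -- in `x` that is the coefficient of `b i`.
  let s : ℕ → R := fun j => q^[j] r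
  have hs : ∀ j, s (j + 1) = q (s j) := fun j => Function.iterate_succ_apply' q j r
  let C : Fin e → ℕ → R := fun i N => ∑ j ∈ Finset.range N, algebraMap k R (c (s j) i) * x ^ j
  have hr : ∀ N, r = ∑ i, C i N * b i + x ^ N * s N := by
    intro N
    induction N with
    | zero => simp [C, s]
    | succ N ih =>
      have h1 : ∀ i, C i (N + 1) = C i N + algebraMap k R (c (s N) i) * x ^ N := fun i => by
        simp only [C, Finset.sum_range_succ]
      rw [ih]
      conv_lhs => rw [hcq (s N)]
      simp only [h1, hs, add_mul, Finset.sum_add_distrib, mul_add, Finset.mul_sum,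
        Algebra.smul_def, pow_succ]
      rw [add_assoc, mul_assoc]
      congr 2
      exact Finset.sum_congr rfl fun i _ => by ring
  have hC : ∀ i N, δ (C i N) = 0 := by
    intro i N
    simp only [C, map_sum, Derivation.leibniz, Derivation.map_algebraMap, Derivation.leibniz_pow,
      hδ, smul_zero, add_zero, Finset.sum_const_zero]
  have hcauchy : ∀ i {M N : ℕ}, M ≤ N → C i M ≡ C i N [SMOD maximalIdeal R ^ M • (⊤ : Ideal R)] := by
    intro i M N hMN
    rw [SModEq.comm, SModEq.sub_mem, smul_eq_mul, Ideal.mul_top]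
    simp only [C]
    rw [← Finset.sum_range_add_sum_Ico _ hMN, add_sub_cancel_left]
    refine Ideal.sum_mem _ fun j hj => Ideal.mul_mem_left _ _ ?_
    exact Ideal.pow_le_pow_right (Finset.mem_Ico.1 hj).1 (Ideal.pow_mem_pow hx j)
  choose L hL using fun i => IsPrecomplete.prec (I := maximalIdeal R) inferInstance (hcauchy i)
  have hL' : ∀ i N, C i N - L i ∈ maximalIdeal R ^ N := fun i N => by
    have := hL i N
    rwa [SModEq.sub_mem, smul_eq_mul, Ideal.mul_top] at this
  refine ⟨L, fun i => ?_, ?_⟩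
  -- The truncations are constants converging to `L i`, so `δ (L i)` lies in every `𝔪 ^ N V`, and
  -- Krull's intersection theorem applies.
  · have : δ (L i) ∈ ⨅ N : ℕ, maximalIdeal R ^ N • (⊤ : Submodule R V) := by
      refine (Submodule.mem_iInf _).2 fun N => ?_
      have := δ.apply_mem_pow_smul_top _ N (hL' i (N + 1))
      rw [map_sub, hC, zero_sub] at this
      exact neg_mem_iff.1 this
    rwa [Ideal.iInf_pow_smul_eq_bot_of_isLocalRing _ (Ideal.IsPrime.ne_top inferInstance),
      Submodule.mem_bot] at this
  · rw [← sub_eq_zero]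
    refine IsHausdorff.haus (I := maximalIdeal R) inferInstance _ fun N => ?_
    rw [SModEq.zero, smul_eq_mul, Ideal.mul_top]
    have : r - ∑ i, L i * b i = ∑ i, (C i N - L i) * b i + x ^ N * s N := by
      conv_lhs => rw [hr N]
      simp only [sub_mul, Finset.sum_sub_distrib]
      ring
    rw [this]
    exact Ideal.add_mem _ (Ideal.sum_mem _ fun i _ => Ideal.mul_mem_right _ _ (hL' i N))
      (Ideal.mul_mem_right _ _ (Ideal.pow_mem_pow hx N))

/-- On a complete local domain of characteristic zero, finite modulo `x`, a derivation into a
finitely generated torsion-free module which kills `x` is zero. -/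
theorem Derivation.eq_zero_of_apply_eq_zero {k R V : Type*} [Field k] [CharZero k] [CommRing R]
    [IsDomain R] [IsLocalRing R]
    [IsNoetherianRing R] [Algebra k R] [IsAdicComplete (maximalIdeal R) R]
    [AddCommGroup V] [Module k V] [Module R V] [IsScalarTower k R V] [Module.Finite R V]
    [Module.IsTorsionFree R V]
    (δ : Derivation k R V) {x : R} (hx : x ∈ maximalIdeal R) (hδ : δ x = 0)
    [Module.Finite k (R ⧸ Ideal.span {x})] (r : R) : δ r = 0 := by
  have : CharZero R := charZero_of_injective_algebraMap (algebraMap k R).injective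
  obtain ⟨e, b', hb'⟩ := Module.Finite.exists_fin (R := k) (M := R ⧸ Ideal.span {x})
  choose b hbb using fun i => Ideal.Quotient.mk_surjective (b' i)
  have hb : ∀ r : R, ∃ c : Fin e → k, ∃ r', r = ∑ i, c i • b i + x * r' := by
    intro r
    have : Ideal.Quotient.mk (Ideal.span {x}) r ∈ Submodule.span k (Set.range b') := by
      rw [hb']; trivial
    obtain ⟨c, hc⟩ := (Submodule.mem_span_range_iff_exists_fun k).1 this
    have h2 : r - ∑ i, c i • b i ∈ Ideal.span {x} := by
      rw [← Ideal.Quotient.eq, map_sum, ← hc]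
      refine Finset.sum_congr rfl fun i _ => ?_
      rw [← hbb, Algebra.smul_def, Algebra.smul_def, map_mul]
      rfl
    obtain ⟨r', hr'⟩ := Ideal.mem_span_singleton'.1 h2
    exact ⟨c, r', by rw [mul_comm, hr']; ring⟩
  have hfin : Module.Finite δ.constants R := by
    classical
    refine ⟨Finset.univ.image b, ?_⟩
    rw [eq_top_iff]
    intro r _
    obtain ⟨c, hc, hr⟩ := exists_eq_sum_constants_mul δ hx hδ hb r
    rw [hr]
    refine Submodule.sum_mem _ fun i _ => ?_
    have : c i * b i = (⟨c i, hc i⟩ : δ.constants) • b i := rfl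
    rw [this]
    exact Submodule.smul_mem _ _ (Submodule.subset_span (by simp))
  exact δ.eq_zero_of_isIntegral_constants (fun r => IsIntegral.of_finite _ r) r

/-! ### Power series presentations and linear parts -/

namespace MvPowerSeries

variable {k : Type*} [Field k] {n : ℕ}

theorem exists_eq_C_add_sum_X_mul (f : MvPowerSeries (Fin n) k) :
    ∃ g : Fin n → MvPowerSeries (Fin n) k, f = C (constantCoeff f) + ∑ i, X i * g i := by
  classical
  rcases isEmpty_or_nonempty (Fin n) with _ | _
  · refine ⟨0, ?_⟩
    ext m
    rw [Subsingleton.elim m 0]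
    simp
  have hex : ∀ m : Fin n →₀ ℕ, m ≠ 0 → ∃ i, m i ≠ 0 := fun m hm => Finsupp.ne_iff.1 hm
  -- `ι m` picks one variable dividing the monomial `m`, so each nonconstant term of `f` is assigned
  -- to exactly one `g i`.
  choose! ι hι using hex
  let g : Fin n → MvPowerSeries (Fin n) k := fun i m =>
    if ι (m + Finsupp.single i 1) = i then coeff (m + Finsupp.single i 1) f else 0
  have hg : ∀ i m, coeff m (g i) =
      if ι (m + Finsupp.single i 1) = i then coeff (m + Finsupp.single i 1) f else 0 :=
    fun _ _ => rfl
  refine ⟨g, ?_⟩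
  ext m
  rw [map_add, map_sum, coeff_C]
  by_cases hm : m = 0
  · subst hm
    rw [if_pos rfl, Finset.sum_eq_zero, add_zero]
    · rfl
    · intro i _
      simp
  · have key : ∀ i, Finsupp.single i 1 ≤ m →
        coeff m (X i * g i) = if ι m = i then coeff m f else 0 := by
      rintro i hle
      obtain ⟨l, rfl⟩ := exists_add_of_le hle
      rw [X, coeff_add_monomial_mul, one_mul, hg, add_comm l]
    rw [if_neg hm, zero_add, Finset.sum_eq_single (ι m)]
    · rw [key _ (Finsupp.single_le_iff.2 (Nat.one_le_iff_ne_zero.2 (hι m hm))), if_pos rfl]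
    · intro i _ hi
      by_cases hle : Finsupp.single i 1 ≤ m
      · rw [key i hle, if_neg (Ne.symm hi)]
      · rw [X, coeff_monomial_mul, if_neg hle]
    · simp

theorem coeff_single_C_add_sum_X_mul (c : k) (g : Fin n → MvPowerSeries (Fin n) k) (i : Fin n) :
    coeff (Finsupp.single i 1) (C c + ∑ j, X j * g j) = constantCoeff (g i) := by
  classical
  rw [map_add, map_sum, coeff_C, if_neg (by simp), zero_add, Finset.sum_eq_single i]
  · have := coeff_add_monomial_mul (Finsupp.single i 1) 0 (g i) (1 : k)
    rw [add_zero] at this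
    rw [X, this, one_mul]
    rfl
  · intro j _ hj
    rw [X, coeff_monomial_mul, if_neg]
    rw [Finsupp.single_le_iff, Finsupp.single_eq_of_ne hj]
    simp
  · simp

end MvPowerSeries

theorem AlgHom.map_mvPowerSeries_C {k R : Type*} [Field k] [CommRing R] [Algebra k R] {n : ℕ}
    (Φ : MvPowerSeries (Fin n) k →ₐ[k] R) (c : k) : Φ (MvPowerSeries.C c) = algebraMap k R c :=
  Φ.commutes c

section Presentation

open MvPowerSeries (C X constantCoeff coeff)

variable {k R : Type*} [Field k] [CommRing R] [IsLocalRing R] [Algebra k R] {n : ℕ}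
  (Φ : MvPowerSeries (Fin n) k →ₐ[k] R)

/-- If `Φ (X i)` had a nonzero residue `c`, then `X i - C c` would be a unit whose image lies in the
maximal ideal. -/
theorem map_X_mem_maximalIdeal (hres : ∀ r : R, ∃ c : k, r - algebraMap k R c ∈ maximalIdeal R)
    (i : Fin n) : Φ (X i) ∈ maximalIdeal R := by
  obtain ⟨c, hc⟩ := hres (Φ (X i))
  by_cases h : c = 0
  · simpa [h] using hc
  · exfalso
    have hu : IsUnit (X i - C c : MvPowerSeries (Fin n) k) := by
      rw [MvPowerSeries.isUnit_iff_constantCoeff]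
      simpa using h
    refine (mem_maximalIdeal _).1 hc ?_
    have := hu.map Φ
    rwa [map_sub, AlgHom.map_mvPowerSeries_C] at this

theorem map_sub_constantCoeff_mem
    (hX : ∀ i, Φ (X i) ∈ maximalIdeal R) (f : MvPowerSeries (Fin n) k) :
    Φ f - algebraMap k R (constantCoeff f) ∈ maximalIdeal R := by
  obtain ⟨g, hg⟩ := MvPowerSeries.exists_eq_C_add_sum_X_mul f
  have : Φ f = algebraMap k R (constantCoeff f) + ∑ i, Φ (X i) * Φ (g i) := by
    conv_lhs => rw [hg]
    simp only [map_add, map_sum, map_mul, AlgHom.map_mvPowerSeries_C]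
  rw [this, add_sub_cancel_left]
  exact Ideal.sum_mem _ fun i _ => Ideal.mul_mem_right _ _ (hX i)

theorem map_sub_linear_mem
    (hX : ∀ i, Φ (X i) ∈ maximalIdeal R) (f : MvPowerSeries (Fin n) k) :
    Φ f - algebraMap k R (constantCoeff f) -
      ∑ i, algebraMap k R (coeff (Finsupp.single i 1) f) * Φ (X i) ∈ maximalIdeal R ^ 2 := by
  obtain ⟨g, hg⟩ := MvPowerSeries.exists_eq_C_add_sum_X_mul f
  have h1 : ∀ i, coeff (Finsupp.single i 1) f = constantCoeff (g i) := fun i => by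
    rw [hg, MvPowerSeries.coeff_single_C_add_sum_X_mul]
  have : Φ f = algebraMap k R (constantCoeff f) + ∑ i, Φ (X i) * Φ (g i) := by
    conv_lhs => rw [hg]
    simp only [map_add, map_sum, map_mul, AlgHom.map_mvPowerSeries_C]
  rw [this, add_sub_cancel_left, ← Finset.sum_sub_distrib]
  refine Ideal.sum_mem _ fun i _ => ?_
  rw [h1, mul_comm, ← sub_mul, pow_two]
  exact Ideal.mul_mem_mul (map_sub_constantCoeff_mem Φ hX _) (hX i)

theorem constantCoeff_eq_zero_iff
    (hX : ∀ i, Φ (X i) ∈ maximalIdeal R) (f : MvPowerSeries (Fin n) k) :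
    constantCoeff f = 0 ↔ Φ f ∈ maximalIdeal R := by
  have h := map_sub_constantCoeff_mem Φ hX f
  constructor
  · intro h0
    simpa [h0] using h
  · intro hf
    refine constant_eq_zero_of_mem_maximalIdeal (R := R) ?_
    simpa using Ideal.sub_mem _ hf h

theorem span_range_map_X
    (hX : ∀ i, Φ (X i) ∈ maximalIdeal R) (hΦ : Function.Surjective Φ) :
    Ideal.span (Set.range fun i => Φ (X i)) = maximalIdeal R := by
  refine le_antisymm (Ideal.span_le.2 (by rintro _ ⟨i, rfl⟩; exact hX i)) fun r hr => ?_
  obtain ⟨f, rfl⟩ := hΦ r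
  obtain ⟨g, hg⟩ := MvPowerSeries.exists_eq_C_add_sum_X_mul f
  rw [(constantCoeff_eq_zero_iff Φ hX f).2 hr] at hg
  rw [hg]
  simp only [map_zero, zero_add, map_sum, map_mul]
  exact Ideal.sum_mem _ fun i _ => Ideal.mul_mem_right _ _ (Ideal.subset_span ⟨i, rfl⟩)

/-- In a minimal presentation, an element of the square of the maximal ideal lifts only to power
series without linear part. -/
theorem coeff_single_eq_zero_of_mem_sq
    (hX : ∀ i, Φ (X i) ∈ maximalIdeal R) [IsNoetherianRing R]
    (hn : (maximalIdeal R).spanFinrank = n) (hΦ : Function.Surjective Φ)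
    {f : MvPowerSeries (Fin n) k} (hf : Φ f ∈ maximalIdeal R ^ 2) (i : Fin n) :
    coeff (Finsupp.single i 1) f = 0 := by
  have h := map_sub_linear_mem Φ hX f
  rw [(constantCoeff_eq_zero_iff Φ hX f).2 (Ideal.pow_le_self two_ne_zero hf), map_zero,
    sub_zero] at h
  have h2 := Ideal.sub_mem _ hf h
  rw [sub_sub_cancel] at h2
  exact congrFun (eq_zero_of_sum_mem_maximalIdeal_sq hn (span_range_map_X Φ hX hΦ) h2) i

/-- The linear part of a power series, as a function of its image in `R`. -/
theorem exists_linearPart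
    (hX : ∀ i, Φ (X i) ∈ maximalIdeal R) [IsNoetherianRing R]
    (hn : (maximalIdeal R).spanFinrank = n) (hΦ : Function.Surjective Φ) :
    ∃ π : R →ₗ[k] (Fin n → k), ∀ f i, π (Φ f) i = coeff (Finsupp.single i 1) f := by
  obtain ⟨σ, hσ⟩ := Φ.toLinearMap.exists_rightInverse_of_surjective
    (LinearMap.range_eq_top.2 hΦ)
  have hσ' : ∀ r, Φ (σ r) = r := fun r => LinearMap.congr_fun hσ r
  refine ⟨(LinearMap.pi fun i => coeff (Finsupp.single i 1)) ∘ₗ σ, fun f i => ?_⟩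
  have : coeff (Finsupp.single i 1) (σ (Φ f) - f) = 0 := by
    refine coeff_single_eq_zero_of_mem_sq Φ hX hn hΦ ?_ i
    rw [map_sub, hσ', sub_self]
    exact Ideal.zero_mem _
  rw [map_sub, sub_eq_zero] at this
  exact this

end Presentation

/-! ### The universal derivation into the universally finite differentials -/

section Differentials

open MvPowerSeries (C X constantCoeff coeff)

variable {k R : Type*} [Field k] [CommRing R] [Algebra k R] {n : ℕ}
  (Φ : MvPowerSeries (Fin n) k →ₐ[k] R)

theorem jacobianColumn_mul (f g : MvPowerSeries (Fin n) k) :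
    jacobianColumn Φ (f * g) = Φ f • jacobianColumn Φ g + Φ g • jacobianColumn Φ f := by
  ext i
  simp [jacobianColumn, Derivation.leibniz]

theorem jacobianColumn_X (i : Fin n) : jacobianColumn Φ (X i) = Pi.single i 1 := by
  classical
  ext j
  by_cases h : i = j
  · subst h
    simp [jacobianColumn]
  · simp [jacobianColumn, MvPowerSeries.pderiv_X_of_ne h, Pi.single_eq_of_ne (Ne.symm h)]

/-- `jacobianColumn` as a `k`-linear map. -/
noncomputable def jacobianColumnₗ : MvPowerSeries (Fin n) k →ₗ[k] (Fin n → R) :=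
  LinearMap.pi fun i => Φ.toLinearMap ∘ₗ (MvPowerSeries.pderiv k i).toLinearMap

theorem jacobianColumnₗ_apply (f : MvPowerSeries (Fin n) k) :
    jacobianColumnₗ Φ f = jacobianColumn Φ f := rfl

/-- The derivation `R → Ω` sending the class of `f` to its Jacobian column. -/
theorem exists_universalDerivation (hΦ : Function.Surjective Φ) :
    ∃ d : Derivation k R (UniversallyFiniteDifferentials Φ), ∀ f,
      d (Φ f) = Submodule.Quotient.mk (jacobianColumn Φ f) := by
  obtain ⟨σ, hσ⟩ := Φ.toLinearMap.exists_rightInverse_of_surjective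
    (LinearMap.range_eq_top.2 hΦ)
  have hσ' : ∀ r, Φ (σ r) = r := fun r => LinearMap.congr_fun hσ r
  let Q := Submodule.span R
    (jacobianColumn Φ '' (RingHom.ker Φ : Set (MvPowerSeries (Fin n) k)))
  let d₀ : R →ₗ[k] UniversallyFiniteDifferentials Φ :=
    (Q.mkQ.restrictScalars k) ∘ₗ jacobianColumnₗ Φ ∘ₗ σ
  have hd : ∀ f, d₀ (Φ f) = Submodule.Quotient.mk (jacobianColumn Φ f) := by
    intro f
    refine (Submodule.Quotient.eq Q).2 ?_
    rw [LinearMap.comp_apply, ← jacobianColumnₗ_apply, ← map_sub, jacobianColumnₗ_apply]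
    refine Submodule.subset_span ⟨_, ?_, rfl⟩
    change Φ _ = 0
    rw [map_sub, hσ', sub_self]
  refine ⟨Derivation.mk' d₀ fun a b => ?_, hd⟩
  obtain ⟨f, rfl⟩ := hΦ a
  obtain ⟨g, rfl⟩ := hΦ b
  rw [← map_mul, hd, hd, hd, jacobianColumn_mul]
  rfl

variable {Φ}

theorem mk_eq_sum_smul {d : Derivation k R (UniversallyFiniteDifferentials Φ)}
    (hd : ∀ f, d (Φ f) = Submodule.Quotient.mk (jacobianColumn Φ f)) (a : Fin n → R) :
    (Submodule.Quotient.mk a : UniversallyFiniteDifferentials Φ) = ∑ i, a i • d (Φ (X i)) := by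
  classical
  simp only [hd, jacobianColumn_X]
  conv_lhs => rw [pi_eq_sum_univ' a]
  rw [← Submodule.mkQ_apply, map_sum]
  refine Finset.sum_congr rfl fun i _ => ?_
  rw [map_smul]
  congr 2

/-- Every derivation into a finitely generated module factors through the universally finite
differentials. -/
theorem exists_linearMap_comp_derivation [IsLocalRing R] [IsNoetherianRing R]
    (hX : ∀ i, Φ (X i) ∈ maximalIdeal R) (hΦ : Function.Surjective Φ)
    {d : Derivation k R (UniversallyFiniteDifferentials Φ)}
    (hd : ∀ f, d (Φ f) = Submodule.Quotient.mk (jacobianColumn Φ f))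
    {E : Type*} [AddCommGroup E] [Module k E] [Module R E] [IsScalarTower k R E] [Module.Finite R E]
    (δ : Derivation k R E) :
    ∃ L : UniversallyFiniteDifferentials Φ →ₗ[R] E, ∀ r, L (d r) = δ r := by
  classical
  let L₀ : (Fin n → R) →ₗ[R] E := Fintype.linearCombination R fun i => δ (Φ (X i))
  have hL₀ : ∀ a, L₀ a = ∑ i, a i • δ (Φ (X i)) := fun a => Fintype.linearCombination_apply ..
  -- `Δ` obeys the Leibniz rule and kills constants and variables; peeling off one variable at a
  -- time puts its values in every `𝔪 ^ N E`, so it vanishes by Krull.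
  let Δ : MvPowerSeries (Fin n) k → E := fun f => δ (Φ f) - L₀ (jacobianColumn Φ f)
  have hΔ : ∀ f g, Δ (f * g) = Φ f • Δ g + Φ g • Δ f := by
    intro f g
    simp only [Δ, map_mul, jacobianColumn_mul, map_add, map_smul, Derivation.leibniz, smul_sub]
    abel
  have hΔX : ∀ i, Δ (X i) = 0 := by
    intro i
    simp only [Δ, hL₀, jacobianColumn_X]
    rw [Finset.sum_eq_single i]
    · simp
    · intro j _ hj
      simp [hj]
    · simp
  have hstep : ∀ (N : ℕ) f, Δ f ∈ maximalIdeal R ^ N • (⊤ : Submodule R E) := by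
    intro N
    induction N with
    | zero => simp
    | succ N ih =>
      intro f
      obtain ⟨g, hg⟩ := MvPowerSeries.exists_eq_C_add_sum_X_mul f
      have hlin : Δ f = Δ (C (constantCoeff f)) + ∑ i, Δ (X i * g i) := by
        conv_lhs => rw [hg]
        simp only [Δ, ← jacobianColumnₗ_apply, map_add, map_sum, Finset.sum_sub_distrib]
        abel
      have hC : Δ (C (constantCoeff f)) = 0 := by
        have h1 : jacobianColumn Φ (C (constantCoeff f)) = 0 := by
          ext i
          simp [jacobianColumn]
        simp only [Δ, h1, map_zero, sub_zero, AlgHom.map_mvPowerSeries_C, Derivation.map_algebraMap]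
      rw [hlin, hC, zero_add]
      refine Submodule.sum_mem _ fun i _ => ?_
      rw [hΔ, hΔX, smul_zero, add_zero, pow_succ', mul_smul]
      exact Submodule.smul_mem_smul (hX i) (ih _)
  have hzero : ∀ f, L₀ (jacobianColumn Φ f) = δ (Φ f) := by
    intro f
    have : Δ f ∈ ⨅ N : ℕ, maximalIdeal R ^ N • (⊤ : Submodule R E) :=
      (Submodule.mem_iInf _).2 fun N => hstep N f
    rw [Ideal.iInf_pow_smul_eq_bot_of_isLocalRing _ (Ideal.IsPrime.ne_top inferInstance),
      Submodule.mem_bot, sub_eq_zero] at this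
    exact this.symm
  refine ⟨Submodule.liftQ _ L₀ ?_, fun r => ?_⟩
  · rw [Submodule.span_le]
    rintro _ ⟨f, hf, rfl⟩
    have hf' : Φ f = 0 := hf
    change L₀ _ = 0
    rw [hzero, hf', map_zero]
  · obtain ⟨f, rfl⟩ := hΦ r
    rw [hd, ← hzero]
    rfl

end Differentials

/-! ### Modules of finite length and reductions in dimension one -/

section FiniteDimensional

variable {k R Y : Type*} [Field k] [CommRing R] [IsLocalRing R] [Algebra k R]
  [AddCommGroup Y] [Module k Y] [Module R Y] [IsScalarTower k R Y]

theorem restrictScalars_fg_of_pow_smul_eq_bot [IsNoetherian R Y]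
    (hres : ∀ r : R, ∃ c : k, r - algebraMap k R c ∈ maximalIdeal R) (N : ℕ) (Z : Submodule R Y)
    (hZ : maximalIdeal R ^ N • Z = ⊥) : (Z.restrictScalars k).FG := by
  induction N generalizing Z with
  | zero =>
    rw [pow_zero, Ideal.one_eq_top, Submodule.top_smul] at hZ
    rw [hZ, Submodule.restrictScalars_bot]
    exact Submodule.fg_bot
  | succ N ih =>
    have h1 := ih (maximalIdeal R • Z) (by rw [← mul_smul, ← pow_succ, hZ])
    obtain ⟨t, rfl⟩ := IsNoetherian.noetherian Z
    suffices h : (Submodule.span R (t : Set Y)).restrictScalars k = Submodule.span k (t : Set Y) ⊔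
        (maximalIdeal R • Submodule.span R (t : Set Y)).restrictScalars k by
      rw [h]
      exact Submodule.FG.sup ⟨t, rfl⟩ h1
    refine le_antisymm (fun z hz => ?_) (sup_le ?_ ?_)
    · rw [Submodule.restrictScalars_mem] at hz
      induction hz using Submodule.span_induction with
      | mem z hz => exact Submodule.mem_sup_left (Submodule.subset_span hz)
      | zero => exact Submodule.zero_mem _
      | add a b ha hb iha ihb => exact Submodule.add_mem _ iha ihb
      | smul r z hz' ih' =>
        obtain ⟨c, hc⟩ := hres r
        have : r • z = c • z + (r - algebraMap k R c) • z := by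
          rw [sub_smul, algebraMap_smul]; abel
        rw [this]
        exact Submodule.add_mem _ (Submodule.smul_mem _ _ ih')
          (Submodule.mem_sup_right ((Submodule.restrictScalars_mem k _ _).2
            (Submodule.smul_mem_smul hc hz')))
    · exact Submodule.span_le.2 Submodule.subset_span
    · intro z hz
      rw [Submodule.restrictScalars_mem] at hz ⊢
      exact Submodule.smul_le_right hz

/-- A finitely generated module killed by a power of the maximal ideal is finite over the
coefficient field. -/
theorem finite_of_pow_maximalIdeal_smul_eq_zero [IsNoetherianRing R] [Module.Finite R Y]
    (hres : ∀ r : R, ∃ c : k, r - algebraMap k R c ∈ maximalIdeal R) {N : ℕ}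
    (h : ∀ r ∈ maximalIdeal R ^ N, ∀ y : Y, r • y = 0) : Module.Finite k Y := by
  have := restrictScalars_fg_of_pow_smul_eq_bot (k := k) hres N (⊤ : Submodule R Y) (by
    rw [eq_bot_iff, Submodule.smul_le]
    intro r hr y _
    rw [h r hr y]
    exact Submodule.zero_mem _)
  rw [Submodule.restrictScalars_top] at this
  exact ⟨this⟩

end FiniteDimensional

/-- In a one-dimensional domain every prime containing `r` is maximal, so the radical of `(r)`
contains `𝔪`. -/
theorem exists_maximalIdeal_pow_le_span_singleton {R : Type*} [CommRing R] [IsDomain R]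
    [IsLocalRing R] [IsNoetherianRing R] (hdim : ringKrullDim R = 1) {r : R} (hr : r ≠ 0) :
    ∃ N : ℕ, maximalIdeal R ^ N ≤ Ideal.span {r} := by
  have hle : Ring.KrullDimLE 1 R := Ring.krullDimLE_iff.2 (by simp [hdim])
  obtain ⟨N, hN⟩ := Ideal.exists_radical_pow_le_of_fg (Ideal.span {r}) (IsNoetherian.noetherian _)
  refine ⟨N, le_trans (Ideal.pow_right_mono ?_ N) hN⟩
  rw [Ideal.radical_eq_sInf]
  refine le_sInf ?_
  rintro P ⟨hP, hprime⟩
  have hP0 : P ≠ ⊥ := by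
    rintro rfl
    exact hr (by simpa using hP)
  have := Ring.krullDimLE_one_iff_of_noZeroDivisors.1 hle P hP0 hprime
  exact (eq_maximalIdeal this).ge

theorem exists_maximalIdeal_pow_smul_eq_zero {R Y : Type*} [CommRing R] [IsDomain R]
    [IsLocalRing R] [IsNoetherianRing R] (hdim : ringKrullDim R = 1) [AddCommGroup Y] [Module R Y]
    [Module.Finite R Y] (hY : Module.IsTorsion R Y) :
    ∃ N : ℕ, ∀ r ∈ maximalIdeal R ^ N, ∀ y : Y, r • y = 0 := by
  obtain ⟨r₀, hr₀, hr₀'⟩ := Submodule.annihilator_top_inter_nonZeroDivisors hY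
  obtain ⟨N, hN⟩ := exists_maximalIdeal_pow_le_span_singleton hdim (nonZeroDivisors.ne_zero hr₀')
  refine ⟨N, fun r hr y => ?_⟩
  obtain ⟨a, rfl⟩ := Ideal.mem_span_singleton'.1 (hN hr)
  rw [mul_smul, Submodule.mem_annihilator.1 hr₀ y trivial, smul_zero]

section Reduction

variable {R : Type*} [CommRing R] [IsLocalRing R] [IsNoetherianRing R]

/-- If `x ∈ 𝔪 ^ 2` then `𝔪 ^ (r + 1) = x 𝔪 ^ r ⊆ 𝔪 ^ (r + 2)`; Nakayama forces `𝔪 = 0`, against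
dimension one. -/
theorem IsReductionOf.notMem_maximalIdeal_sq [IsDomain R] (hdim : ringKrullDim R = 1) {x : R}
    (hx : IsReductionOf (Ideal.span {x}) (maximalIdeal R)) : x ∉ maximalIdeal R ^ 2 := by
  intro hx2
  obtain ⟨-, r, hr⟩ := hx
  have hbot : maximalIdeal R ^ (r + 1) = ⊥ := by
    refine Submodule.eq_bot_of_le_smul_of_le_jacobson_bot (maximalIdeal R) _
      (IsNoetherian.noetherian _) ?_ (IsLocalRing.maximalIdeal_le_jacobson _)
    rw [smul_eq_mul, ← pow_succ']
    nth_rw 1 [← hr]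
    rw [show r + 1 + 1 = 2 + r by ring, pow_add]
    exact Ideal.mul_mono_left ((Ideal.span_singleton_le_iff_mem _).2 hx2)
  have h0 : maximalIdeal R = ⊥ := pow_eq_zero_iff (Nat.succ_ne_zero r) |>.1 hbot
  have := ringKrullDim_eq_zero_of_isField (isField_iff_maximalIdeal_eq.2 h0)
  rw [hdim] at this
  exact one_ne_zero this

theorem IsReductionOf.finite_quotient {k : Type*} [Field k] [Algebra k R]
    (hres : ∀ r : R, ∃ c : k, r - algebraMap k R c ∈ maximalIdeal R) {x : R}
    (hx : IsReductionOf (Ideal.span {x}) (maximalIdeal R)) :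
    Module.Finite k (R ⧸ Ideal.span {x}) := by
  obtain ⟨-, N, hN⟩ := hx
  refine finite_of_pow_maximalIdeal_smul_eq_zero (R := R) hres (N := N + 1) fun r hr y => ?_
  obtain ⟨a, rfl⟩ := Ideal.Quotient.mk_surjective y
  have hr' : r ∈ Ideal.span {x} := (hN ▸ Ideal.mul_le_left : maximalIdeal R ^ (N + 1) ≤ _) hr
  rw [Algebra.smul_def, Ideal.Quotient.algebraMap_eq, Ideal.Quotient.eq_zero_iff_mem.2 hr',
    zero_mul]

end Reduction

/-! ### Upper bound for `dim Y / xY` -/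

section UpperBound

variable {k R M : Type*} [Field k] [CommRing R] [Algebra k R]
  [AddCommGroup M] [Module k M] [Module R M] [IsScalarTower k R M]

variable (k) in
/-- Multiplication by `x` on a module over the `k`-algebra `R`, as a `k`-linear map. -/
noncomputable def smulₗ (Y : Type*) [AddCommGroup Y] [Module k Y] [Module R Y]
    [IsScalarTower k R Y] (x : R) : Y →ₗ[k] Y :=
  (LinearMap.lsmul R Y x).restrictScalars k

theorem smulₗ_apply {Y : Type*} [AddCommGroup Y] [Module k Y] [Module R Y]
    [IsScalarTower k R Y] (x : R) (y : Y) : smulₗ k Y x y = x • y := rfl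

theorem finrank_coker_eq_finrank_ker {Y : Type*} [AddCommGroup Y] [Module k Y] [Module.Finite k Y]
    (T : Y →ₗ[k] Y) :
    Module.finrank k (Y ⧸ LinearMap.range T) = Module.finrank k (LinearMap.ker T) := by
  have h1 := Submodule.finrank_quotient_add_finrank (LinearMap.range T)
  have h2 := LinearMap.finrank_range_add_finrank_ker T
  omega

/-- Let `M` be torsion-free and `ω ∈ M` outside `x M`. If `Y = M / R ω` is finite over `k`, then
`dim Y / x Y < dim R / x R`. -/
theorem finrank_coker_smul_lt [IsDomain R] [Module.IsTorsionFree R M] {x : R} (hx : x ≠ 0) {ω : M}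
    (hω : ∀ ω' : M, ω ≠ x • ω') [Module.Finite k (M ⧸ Submodule.span R {ω})]
    [Module.Finite k (R ⧸ Ideal.span {x})] :
    Module.finrank k ((M ⧸ Submodule.span R {ω}) ⧸
      LinearMap.range (smulₗ k (M ⧸ Submodule.span R {ω}) x)) <
      Module.finrank k (R ⧸ Ideal.span {x}) := by
  rw [finrank_coker_eq_finrank_ker]
  let K := LinearMap.ker (smulₗ k (M ⧸ Submodule.span R {ω}) x)
  let b := Module.finBasis k K
  choose m hm using fun i => Submodule.Quotient.mk_surjective _ (b i : M ⧸ Submodule.span R {ω})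
  have hr : ∀ i, ∃ r : R, r • ω = x • m i := by
    intro i
    have h1 : x • (b i : M ⧸ Submodule.span R {ω}) = 0 := (b i).2
    rw [← hm, ← Submodule.Quotient.mk_smul, Submodule.Quotient.mk_eq_zero] at h1
    exact Submodule.mem_span_singleton.1 h1
  choose r hr using hr
  -- The index `none` stands for the class of 1; its independence from the `r i` makes the final
  -- inequality strict.
  let F : Option (Fin (Module.finrank k K)) → R ⧸ Ideal.span {x} := fun o =>
    Ideal.Quotient.mk _ (o.elim 1 r)
  have hF : LinearIndependent k F := by
    rw [Fintype.linearIndependent_iff]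
    intro c hc
    have hmem : c none • (1 : R) + ∑ i, c (some i) • r i ∈ Ideal.span {x} := by
      rw [← Ideal.Quotient.eq_zero_iff_mem, ← hc, Fintype.sum_option, map_add, map_sum]
      rfl
    obtain ⟨a, ha⟩ := Ideal.mem_span_singleton'.1 hmem
    have h1 : c none • ω = x • (a • ω - ∑ i, c (some i) • m i) := by
      have := congrArg (· • ω) ha
      simp only [add_smul, Finset.sum_smul, smul_assoc, one_smul, hr] at this
      rw [smul_sub, ← mul_smul, mul_comm x a, this, Finset.smul_sum]
      simp only [smul_comm x]
      abel
    have h0 : c none = 0 := by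
      by_contra hne
      refine hω ((c none)⁻¹ • (a • ω - ∑ i, c (some i) • m i)) ?_
      rw [smul_comm x, ← h1, smul_smul, inv_mul_cancel₀ hne, one_smul]
    rw [h0, zero_smul] at h1
    have h2 : a • ω - ∑ i, c (some i) • m i = 0 := (smul_eq_zero.1 h1.symm).resolve_left hx
    have h3 : ∑ i, c (some i) • b i = 0 := by
      apply Subtype.ext
      rw [Submodule.coe_sum]
      simp only [Submodule.coe_smul, ← hm, Submodule.coe_zero]
      rw [sub_eq_zero] at h2
      have h4 : (Submodule.Quotient.mk (∑ i, c (some i) • m i) : M ⧸ Submodule.span R {ω}) = 0 := by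
        rw [Submodule.Quotient.mk_eq_zero, ← h2]
        exact Submodule.smul_mem _ _ (Submodule.mem_span_singleton_self ω)
      rw [← h4, ← Submodule.mkQ_apply, map_sum]
      rfl
    have h5 := Fintype.linearIndependent_iff.1 b.linearIndependent _ h3
    rintro (_ | i)
    · exact h0
    · exact h5 i
  have := hF.fintype_card_le_finrank
  simp only [Fintype.card_option, Fintype.card_fin] at this
  exact this

end UpperBound

/-! ### Linear algebra and exterior squares for the lower bound -/

/-- Let `ρ` and `ψ` be surjections out of `X` with `ker ρ ≤ ker ψ`, and let `d : P → ker ψ`. If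
the kernel of `ρ ∘ d` lies in the kernel of a surjection `P → T`, then
`dim Λ + dim T` is at most the dimension of the target of `ρ`. -/
theorem finrank_add_finrank_le {k P X W Λ T : Type*} [Field k] [AddCommGroup P] [Module k P]
    [AddCommGroup X] [Module k X] [AddCommGroup W] [Module k W] [Module.Finite k W]
    [AddCommGroup Λ] [Module k Λ] [AddCommGroup T] [Module k T]
    (ρ : X →ₗ[k] W) (hρ : Function.Surjective ρ) (ψ : X →ₗ[k] Λ) (hψ : Function.Surjective ψ)
    (hρψ : ∀ a, ρ a = 0 → ψ a = 0) (d : P →ₗ[k] X) (hd : ∀ p, ψ (d p) = 0)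
    (q : P →ₗ[k] T) (hq : Function.Surjective q) (hdq : ∀ p, ρ (d p) = 0 → q p = 0) :
    Module.finrank k Λ + Module.finrank k T ≤ Module.finrank k W := by
  obtain ⟨σ, hσ⟩ := ρ.exists_rightInverse_of_surjective (LinearMap.range_eq_top.2 hρ)
  have hσ' : ∀ w, ρ (σ w) = w := fun w => LinearMap.congr_fun hσ w
  -- `ψ` factors through `ρ` as `ψ'`, whose kernel contains the image of `ρ ∘ d`; rank-nullity for
  -- `ψ'` then adds the two dimensions.
  let ψ' := ψ ∘ₗ σ
  have hψ' : ∀ a, ψ' (ρ a) = ψ a := fun a => by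
    have := hρψ (σ (ρ a) - a) (by rw [map_sub, hσ', sub_self])
    rwa [map_sub, sub_eq_zero] at this
  have hsurj : Function.Surjective ψ' := fun l => by
    obtain ⟨a, rfl⟩ := hψ l
    exact ⟨ρ a, hψ' a⟩
  let e := ρ ∘ₗ d
  have hle : LinearMap.range e ≤ LinearMap.ker ψ' := by
    rintro _ ⟨p, rfl⟩
    exact (hψ' _).trans (hd p)
  have hT : Module.finrank k T ≤ Module.finrank k (LinearMap.range e) := by
    have h1 : LinearMap.ker e ≤ LinearMap.ker q := fun p hp => hdq p hp
    have hs : Function.Surjective ((LinearMap.ker e).liftQ q h1 ∘ₗ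
        e.quotKerEquivRange.symm.toLinearMap) := by
      intro t
      obtain ⟨p, rfl⟩ := hq t
      exact ⟨e.quotKerEquivRange (Submodule.Quotient.mk p), by simp⟩
    exact LinearMap.finrank_le_finrank_of_surjective hs
  have h2 := LinearMap.finrank_range_add_finrank_ker ψ'
  rw [LinearMap.range_eq_top.2 hsurj, finrank_top] at h2
  have h3 := Submodule.finrank_mono hle
  omega

section Wedge

theorem update_vec_two {V : Type*} (a b c : V) : Function.update ![a, b] 1 c = ![a, c] := by
  ext i
  fin_cases i <;> rfl

variable (k V : Type*) [Field k] [AddCommGroup V] [Module k V]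

/-- The wedge product `V × V → ⋀² V` as a bilinear map. -/
noncomputable def wedgeₗ : V →ₗ[k] V →ₗ[k] ⋀[k]^2 V :=
  LinearMap.mk₂ k (fun a b => exteriorPower.ιMulti k 2 ![a, b])
    (fun a a' b => (exteriorPower.ιMulti k 2).map_vecCons_add ![b] a a')
    (fun c a b => (exteriorPower.ιMulti k 2).map_vecCons_smul ![b] c a)
    (fun a b b' => by
      have := (exteriorPower.ιMulti k 2).map_update_add ![a, 0] 1 b b'
      simpa only [update_vec_two] using this)
    (fun c a b => by
      have := (exteriorPower.ιMulti k 2).map_update_smul ![a, 0] 1 c b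
      simpa only [update_vec_two] using this)

variable {k V}

theorem wedgeₗ_apply (a b : V) : wedgeₗ k V a b = exteriorPower.ιMulti k 2 ![a, b] := rfl

theorem wedgeₗ_zero_left (b : V) : wedgeₗ k V 0 b = 0 := by
  rw [LinearMap.map_zero, LinearMap.zero_apply]

theorem wedgeₗ_zero_right (a : V) : wedgeₗ k V a 0 = 0 := LinearMap.map_zero _

theorem wedgeₗ_self (a : V) : wedgeₗ k V a a = 0 :=
  (exteriorPower.ιMulti k 2).map_eq_zero_of_eq ![a, a] (i := 0) (j := 1) rfl (by decide)

theorem wedgeₗ_swap (a b : V) : wedgeₗ k V a b = -wedgeₗ k V b a := by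
  have := wedgeₗ_self (k := k) (a + b)
  simp only [map_add, LinearMap.add_apply, wedgeₗ_self, zero_add, add_zero] at this
  exact eq_neg_of_add_eq_zero_right this

theorem sum_symm_smul_wedgeₗ [CharZero k] {ι : Type*} [Fintype ι] (H : ι → ι → k)
    (hH : ∀ i j, H i j = H j i) (e : ι → V) :
    ∑ i, ∑ j, H i j • wedgeₗ k V (e j) (e i) = 0 := by
  have h : ∑ i, ∑ j, H i j • wedgeₗ k V (e j) (e i) =
      -∑ i, ∑ j, H i j • wedgeₗ k V (e j) (e i) := by
    conv_lhs => rw [Finset.sum_comm]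
    rw [← Finset.sum_neg_distrib]
    refine Finset.sum_congr rfl fun i _ => ?_
    rw [← Finset.sum_neg_distrib]
    refine Finset.sum_congr rfl fun j _ => ?_
    rw [wedgeₗ_swap, hH, smul_neg]
  have h2 : (2 : k) • ∑ i, ∑ j, H i j • wedgeₗ k V (e j) (e i) = 0 := by
    rw [two_smul]
    nth_rw 1 [h]
    exact neg_add_cancel _
  exact (smul_eq_zero.1 h2).resolve_left two_ne_zero

end Wedge

/-! ### The exterior derivative modulo the maximal ideal -/

section LinearPart

open MvPowerSeries (C X constantCoeff coeff)

variable {k R : Type*} [Field k] [CommRing R] [Algebra k R] {n : ℕ}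
  {Φ : MvPowerSeries (Fin n) k →ₐ[k] R}

theorem MvPowerSeries.constantCoeff_pderiv (f : MvPowerSeries (Fin n) k) (i : Fin n) :
    constantCoeff (MvPowerSeries.pderiv k i f) = coeff (Finsupp.single i 1) f := by
  rw [← MvPowerSeries.coeff_zero_eq_constantCoeff_apply, MvPowerSeries.coeff_pderiv]
  simp

theorem MvPowerSeries.coeff_single_pderiv_comm (f : MvPowerSeries (Fin n) k) (i j : Fin n) :
    coeff (Finsupp.single j 1) (MvPowerSeries.pderiv k i f) =
      coeff (Finsupp.single i 1) (MvPowerSeries.pderiv k j f) := by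
  rw [MvPowerSeries.coeff_pderiv, MvPowerSeries.coeff_pderiv, add_comm (Finsupp.single j 1)]
  by_cases h : i = j
  · subst h; rfl
  · rw [Finsupp.single_eq_of_ne h, Finsupp.single_eq_of_ne (Ne.symm h)]

variable {π : R →ₗ[k] (Fin n → k)}

theorem linearPart_mul
    (hπ : ∀ f i, π (Φ f) i = coeff (Finsupp.single i 1) f) (f g : MvPowerSeries (Fin n) k) :
    π (Φ f * Φ g) = constantCoeff f • π (Φ g) + constantCoeff g • π (Φ f) := by
  ext i
  rw [← map_mul, hπ, ← MvPowerSeries.constantCoeff_pderiv, Derivation.leibniz]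
  simp [MvPowerSeries.constantCoeff_pderiv, hπ]

theorem linearPart_X
    (hπ : ∀ f i, π (Φ f) i = coeff (Finsupp.single i 1) f) (i : Fin n) :
    π (Φ (X i)) = Pi.single i 1 := by
  classical
  ext j
  rw [hπ, MvPowerSeries.coeff_X, Pi.single_apply]
  simp [Finsupp.single_left_inj, eq_comm]

theorem linearPart_eq_sum
    (hπ : ∀ f i, π (Φ f) i = coeff (Finsupp.single i 1) f) (f : MvPowerSeries (Fin n) k) :
    π (Φ f) = ∑ i, coeff (Finsupp.single i 1) f • π (Φ (X i)) := by
  classical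
  ext j
  simp [linearPart_X hπ, hπ, Pi.single_apply]

/-- The exterior derivative `r dr' ↦ dr ∧ dr'`, modulo the maximal ideal. -/
theorem exists_exteriorDerivative
    (hπ : ∀ f i, π (Φ f) i = coeff (Finsupp.single i 1) f) [CharZero k] (hΦ : Function.Surjective Φ)
    {d : Derivation k R (UniversallyFiniteDifferentials Φ)}
    (hd : ∀ f, d (Φ f) = Submodule.Quotient.mk (jacobianColumn Φ f)) :
    ∃ ψ : UniversallyFiniteDifferentials Φ →ₗ[k] ⋀[k]^2 (Fin n → k),
      ∀ r r', ψ (r • d r') = wedgeₗ k _ (π r) (π r') := by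
  let ψ₀ : (Fin n → R) →ₗ[k] ⋀[k]^2 (Fin n → k) :=
    ∑ i, (wedgeₗ k (Fin n → k)).flip (π (Φ (X i))) ∘ₗ π ∘ₗ LinearMap.proj i
  have hψ₀ : ∀ a, ψ₀ a = ∑ i, wedgeₗ k _ (π (a i)) (π (Φ (X i))) := fun a => by simp [ψ₀]
  have key : ∀ r f, ψ₀ (r • jacobianColumn Φ f) = wedgeₗ k _ (π r) (π (Φ f)) := by
    intro r f
    obtain ⟨g, rfl⟩ := hΦ r
    -- By the product rule the linear part of `g ∂f/∂Xᵢ` splits in two: the first piece carries the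
    -- Hessian of `f` at 0, whose symmetry cancels it against the wedge, and the second sums to `dg
    -- ∧ df`.
    have h1 : ∀ i, wedgeₗ k _ (π ((Φ g • jacobianColumn Φ f) i)) (π (Φ (X i))) =
        constantCoeff g • (∑ j, coeff (Finsupp.single j 1) (MvPowerSeries.pderiv k i f) •
          wedgeₗ k _ (π (Φ (X j))) (π (Φ (X i)))) +
        wedgeₗ k _ (π (Φ g)) (coeff (Finsupp.single i 1) f • π (Φ (X i))) := by
      intro i
      rw [Pi.smul_apply, smul_eq_mul, jacobianColumn, linearPart_mul hπ,
        MvPowerSeries.constantCoeff_pderiv]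
      nth_rw 1 [linearPart_eq_sum hπ (MvPowerSeries.pderiv k i f)]
      simp only [map_add, map_smul, map_sum, LinearMap.add_apply, LinearMap.smul_apply,
        LinearMap.sum_apply]
    rw [hψ₀, Finset.sum_congr rfl fun i _ => h1 i, Finset.sum_add_distrib, ← Finset.smul_sum,
      sum_symm_smul_wedgeₗ _ (fun i j => MvPowerSeries.coeff_single_pderiv_comm f i j)
        (fun i => π (Φ (X i))), smul_zero, zero_add, ← map_sum, ← linearPart_eq_sum hπ]
  let Q := Submodule.span R
    (jacobianColumn Φ '' (RingHom.ker Φ : Set (MvPowerSeries (Fin n) k)))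
  have hQ : Q.restrictScalars k ≤ LinearMap.ker ψ₀ := by
    intro a ha
    rw [Submodule.restrictScalars_mem] at ha
    obtain ⟨c, t, ht, -, rfl⟩ := Submodule.mem_span_iff_exists_finset_subset.1 ha
    rw [LinearMap.mem_ker, map_sum]
    refine Finset.sum_eq_zero fun u hu => ?_
    obtain ⟨f, hf, rfl⟩ := ht hu
    have hf' : Φ f = 0 := hf
    rw [key, hf', map_zero, map_zero]
  refine ⟨(Q.restrictScalars k).liftQ ψ₀ hQ, fun r r' => ?_⟩
  obtain ⟨f, rfl⟩ := hΦ r'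
  rw [hd, ← key]
  rfl

end LinearPart

/-! ### The form `dx` and the quotient `Y = Ω / R dx` -/

section Bounds

open MvPowerSeries (C X constantCoeff coeff)

variable {k R : Type*} [Field k] [CommRing R] [IsLocalRing R] [IsNoetherianRing R] [Algebra k R]
  {n : ℕ} {Φ : MvPowerSeries (Fin n) k →ₐ[k] R}

/-- In a minimal presentation relations have no linear part, so their Jacobian columns have entries
in `𝔪`. An equality `dx = x ω` would then kill the linear part of a lift of `x`, putting `x` in `𝔪 ^
2`. -/
theorem derivation_ne_smul (hX : ∀ i, Φ (X i) ∈ maximalIdeal R)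
    (hn : (maximalIdeal R).spanFinrank = n) (hΦ : Function.Surjective Φ)
    {d : Derivation k R (UniversallyFiniteDifferentials Φ)}
    (hd : ∀ f, d (Φ f) = Submodule.Quotient.mk (jacobianColumn Φ f))
    {x : R} (hx : x ∈ maximalIdeal R) (hx2 : x ∉ maximalIdeal R ^ 2)
    (ω : UniversallyFiniteDifferentials Φ) : d x ≠ x • ω := by
  intro h
  obtain ⟨ξ, hξ⟩ := hΦ x
  obtain ⟨a, rfl⟩ := Submodule.Quotient.mk_surjective _ ω
  rw [← hξ, hd, ← Submodule.Quotient.mk_smul, Submodule.Quotient.eq] at h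
  have hcol : ∀ b ∈ Submodule.span R
      (jacobianColumn Φ '' (RingHom.ker Φ : Set (MvPowerSeries (Fin n) k))),
      ∀ i, b i ∈ maximalIdeal R := by
    intro b hb i
    induction hb using Submodule.span_induction with
    | mem b hb =>
      obtain ⟨f, hf, rfl⟩ := hb
      have hf' : Φ f = 0 := hf
      rw [jacobianColumn, ← constantCoeff_eq_zero_iff Φ hX, MvPowerSeries.constantCoeff_pderiv]
      exact coeff_single_eq_zero_of_mem_sq Φ hX hn hΦ (by rw [hf']; exact Ideal.zero_mem _) i
    | zero => exact Ideal.zero_mem _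
    | add a b _ _ ha hb => exact Ideal.add_mem _ ha hb
    | smul r b _ hb => exact Ideal.mul_mem_left _ _ hb
  have hlin : ∀ i, coeff (Finsupp.single i 1) ξ = 0 := by
    intro i
    rw [← MvPowerSeries.constantCoeff_pderiv, constantCoeff_eq_zero_iff Φ hX]
    have h1 := hcol _ h i
    have h2 : Φ ξ * a i ∈ maximalIdeal R := Ideal.mul_mem_right _ _ (hξ ▸ hx)
    have := Ideal.add_mem _ h1 h2
    simpa [jacobianColumn] using this
  have := map_sub_linear_mem Φ hX ξ
  rw [(constantCoeff_eq_zero_iff Φ hX ξ).2 (hξ ▸ hx), hξ] at this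
  simp only [hlin, map_zero, zero_mul, Finset.sum_const_zero, sub_zero] at this
  exact hx2 this

/-- The derivation induced by `d` into `Y` modulo torsion kills `x`, hence vanishes; as the
differentials generate Ω, that quotient is zero. -/
theorem quotient_isTorsion [IsDomain R] [CharZero k] [IsAdicComplete (maximalIdeal R) R]
    {d : Derivation k R (UniversallyFiniteDifferentials Φ)}
    (hd : ∀ f, d (Φ f) = Submodule.Quotient.mk (jacobianColumn Φ f))
    {x : R} (hx : x ∈ maximalIdeal R) [Module.Finite k (R ⧸ Ideal.span {x})] :
    Module.IsTorsion R (UniversallyFiniteDifferentials Φ ⧸ Submodule.span R {d x}) := by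
  let Y := UniversallyFiniteDifferentials Φ ⧸ Submodule.span R {d x}
  let p : UniversallyFiniteDifferentials Φ →ₗ[R] Y ⧸ Submodule.torsion R Y :=
    (Submodule.torsion R Y).mkQ ∘ₗ (Submodule.span R {d x}).mkQ
  let δ : Derivation k R (Y ⧸ Submodule.torsion R Y) := p.compDer d
  have hδx : δ x = 0 := by
    have : (Submodule.span R {d x}).mkQ (d x) = 0 :=
      (Submodule.Quotient.mk_eq_zero _).2 (Submodule.mem_span_singleton_self _)
    change (Submodule.torsion R Y).mkQ ((Submodule.span R {d x}).mkQ (d x)) = 0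
    rw [this, map_zero]
  have hδ : ∀ r, p (d r) = 0 := fun r => δ.eq_zero_of_apply_eq_zero hx hδx r
  intro y
  obtain ⟨ω, rfl⟩ := Submodule.Quotient.mk_surjective _ y
  obtain ⟨a, rfl⟩ := Submodule.Quotient.mk_surjective _ ω
  have hp : p (Submodule.Quotient.mk a) = 0 := by
    rw [mk_eq_sum_smul hd, map_sum]
    exact Finset.sum_eq_zero fun i _ => by rw [map_smul, hδ, smul_zero]
  exact (Submodule.mem_torsion_iff _).1 ((Submodule.Quotient.mk_eq_zero _).1 hp)

end Bounds

theorem exists_eq_add_of_mk_mk_eq_zero {k R M : Type*} [Field k] [CommRing R] [Algebra k R]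
    [AddCommGroup M] [Module k M] [Module R M]
    [IsScalarTower k R M] {x : R} {ω m : M}
    (h : (LinearMap.range (smulₗ k (M ⧸ Submodule.span R {ω}) x)).mkQ
      (Submodule.Quotient.mk m) = 0) : ∃ (m' : M) (r : R), m = x • m' + r • ω := by
  obtain ⟨y, hy⟩ := (Submodule.Quotient.mk_eq_zero _).1 h
  obtain ⟨m', rfl⟩ := Submodule.Quotient.mk_surjective _ y
  rw [smulₗ_apply, ← Submodule.Quotient.mk_smul, eq_comm, Submodule.Quotient.eq] at hy
  obtain ⟨r, hr⟩ := Submodule.mem_span_singleton.1 hy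
  exact ⟨m', r, by rw [hr]; abel⟩

theorem finrank_sub_one_le_finrank_quotient_span_singleton {k V : Type*} [Field k]
    [AddCommGroup V] [Module k V] [Module.Finite k V] (u : V) :
    Module.finrank k V - 1 ≤ Module.finrank k (V ⧸ Submodule.span k {u}) := by
  have h1 := Submodule.finrank_quotient_add_finrank (Submodule.span k {u})
  have h2 : Module.finrank k (Submodule.span k {u}) ≤ 1 := by
    simpa using finrank_span_le_card (R := k) ({u} : Set V)
  omega

/-- An exterior derivative on `M` modulo the maximal ideal descends to `M / (x M + R dx)`. -/
theorem exists_exteriorDerivative_quotient {k R M V V' : Type*} [Field k] [CommRing R] [Algebra k R]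
    [AddCommGroup M] [Module k M] [Module R M] [AddCommGroup V] [Module k V]
    [AddCommGroup V'] [Module k V']
    (d : Derivation k R M) {n : ℕ} {y : Fin n → R}
    (hy : ∀ ω : M, ∃ a : Fin n → R, ω = ∑ i, a i • d (y i))
    {π : R →ₗ[k] V} (hπ : Function.Surjective π) (hπ1 : π 1 = 0)
    {ψ : M →ₗ[k] ⋀[k]^2 V} (hψ : ∀ r r', ψ (r • d r') = wedgeₗ k V (π r) (π r'))
    {x : R} (hx : ∀ a, ∃ c : k, π (x * a) = c • π x)
    {κ : V →ₗ[k] V'} (hκs : Function.Surjective κ) (hκ : κ (π x) = 0) :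
    ∃ ψ' : M →ₗ[k] ⋀[k]^2 V', Function.Surjective ψ' ∧
      (∀ r, ψ' (d r) = 0) ∧ ∀ (ω : M) (r : R), ψ' (x • ω + r • d x) = 0 := by
  obtain ⟨ψ', hψ'⟩ : ∃ ψ' : M →ₗ[k] ⋀[k]^2 V',
      ∀ r r', ψ' (r • d r') = wedgeₗ k _ (κ (π r)) (κ (π r')) := by
    refine ⟨exteriorPower.map 2 κ ∘ₗ ψ, fun r r' => ?_⟩
    rw [LinearMap.comp_apply, hψ, wedgeₗ_apply, exteriorPower.map_apply_ιMulti, wedgeₗ_apply]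
    congr 1
    ext i
    fin_cases i <;> rfl
  refine ⟨ψ', ?_, fun r => ?_, fun ω r => ?_⟩
  · rw [← LinearMap.range_eq_top, eq_top_iff, ← exteriorPower.ιMulti_span, Submodule.span_le]
    rintro _ ⟨a, rfl⟩
    obtain ⟨u₀, hu₀⟩ := hκs (a 0)
    obtain ⟨u₁, hu₁⟩ := hκs (a 1)
    obtain ⟨r₀, rfl⟩ := hπ u₀
    obtain ⟨r₁, rfl⟩ := hπ u₁
    refine ⟨r₀ • d r₁, ?_⟩
    rw [hψ', wedgeₗ_apply]
    congr 1
    ext i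
    fin_cases i
    · exact hu₀
    · exact hu₁
  -- Exact forms die because `dr = 1 • dr` and 1 has no linear part.
  · have := hψ' 1 r
    rwa [one_smul, hπ1, LinearMap.map_zero κ, wedgeₗ_zero_left] at this
  · obtain ⟨a, rfl⟩ := hy ω
    rw [Finset.smul_sum, LinearMap.map_add, map_sum, hψ', hκ, wedgeₗ_zero_right, add_zero]
    refine Finset.sum_eq_zero fun i _ => ?_
    obtain ⟨c, hc⟩ := hx (a i)
    rw [smul_smul, hψ', hc, LinearMap.map_smul, hκ, smul_zero, wedgeₗ_zero_left]

theorem finrank_add_finrank_le_finrank_coker_smul {k R M Λ T : Type*} [Field k] [CommRing R]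
    [Algebra k R] [AddCommGroup M] [Module k M] [Module R M] [IsScalarTower k R M]
    [AddCommGroup Λ] [Module k Λ] [AddCommGroup T] [Module k T]
    (d : Derivation k R M) {x : R} [Module.Finite k (M ⧸ Submodule.span R {d x})]
    {ψ : M →ₗ[k] Λ} (hψ : Function.Surjective ψ) (hψd : ∀ r, ψ (d r) = 0)
    (hψx : ∀ (ω : M) (r : R), ψ (x • ω + r • d x) = 0)
    {q : R →ₗ[k] T} (hq : Function.Surjective q)
    (hdq : ∀ (r a : R) (ω : M), d r = x • ω + a • d x → q r = 0) :
    Module.finrank k Λ + Module.finrank k T ≤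
      Module.finrank k ((M ⧸ Submodule.span R {d x}) ⧸
        LinearMap.range (smulₗ k (M ⧸ Submodule.span R {d x}) x)) := by
  let Y := M ⧸ Submodule.span R {d x}
  let ρ : M →ₗ[k] Y ⧸ LinearMap.range (smulₗ k Y x) :=
    (LinearMap.range (smulₗ k Y x)).mkQ ∘ₗ (Submodule.span R {d x}).mkQ.restrictScalars k
  have hρ : Function.Surjective ρ := by
    intro w
    obtain ⟨y, rfl⟩ := Submodule.mkQ_surjective _ w
    obtain ⟨m, rfl⟩ := Submodule.mkQ_surjective _ y
    exact ⟨m, rfl⟩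
  refine finrank_add_finrank_le ρ hρ ψ hψ (fun ω hω => ?_) d.toLinearMap hψd q hq fun r hr => ?_
  · obtain ⟨ω', r, rfl⟩ := exists_eq_add_of_mk_mk_eq_zero hω
    exact hψx ω' r
  · obtain ⟨ω', a, h⟩ := exists_eq_add_of_mk_mk_eq_zero hr
    exact hdq r a ω' h

/-! ### Lower bound for `dim Y / xY` -/

section LowerBound

open MvPowerSeries (C X constantCoeff coeff)

variable {k R : Type*} [Field k] [CommRing R] [IsLocalRing R] [IsNoetherianRing R] [Algebra k R]

theorem exists_sub_algebraMap_mem_of_D_mk_eq_zero [CharZero k]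
    (hres : ∀ r : R, ∃ c : k, r - algebraMap k R c ∈ maximalIdeal R) {b : Ideal R}
    (hb : maximalIdeal R ^ 4 ≤ b) {r : R}
    (hr : KaehlerDifferential.D k (R ⧸ b) (Ideal.Quotient.mk b r) = 0) :
    ∃ c : k, Ideal.Quotient.mk b r = algebraMap k (R ⧸ b) c := by
  by_cases hbt : b = ⊤
  · subst hbt
    exact ⟨0, Subsingleton.elim _ _⟩
  have : Nontrivial (R ⧸ b) := Ideal.Quotient.nontrivial_iff.2 hbt
  have : IsLocalRing (R ⧸ b) :=
    IsLocalRing.of_surjective' (Ideal.Quotient.mk b) Ideal.Quotient.mk_surjective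
  have hle : maximalIdeal (R ⧸ b) ≤ (maximalIdeal R).map (Ideal.Quotient.mk b) := by
    intro y hy
    obtain ⟨a, rfl⟩ := Ideal.Quotient.mk_surjective y
    refine Ideal.mem_map_of_mem _ ((mem_maximalIdeal _).2 fun ha => ?_)
    exact (mem_maximalIdeal _).1 hy (ha.map _)
  have hge : (maximalIdeal R).map (Ideal.Quotient.mk b) ≤ maximalIdeal (R ⧸ b) := by
    refine le_maximalIdeal fun h => ?_
    have h1 : Ideal.comap (Ideal.Quotient.mk b) ((maximalIdeal R).map (Ideal.Quotient.mk b)) = ⊤ := by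
      rw [h, Ideal.comap_top]
    rw [Ideal.comap_map_of_surjective _ Ideal.Quotient.mk_surjective, ← RingHom.ker_eq_comap_bot,
      Ideal.mk_ker, sup_eq_left.2 (le_maximalIdeal hbt)] at h1
    exact Ideal.IsPrime.ne_top inferInstance h1
  refine exists_eq_algebraMap_of_D_eq_zero ?_ ?_ hr
  · intro y
    obtain ⟨a, rfl⟩ := Ideal.Quotient.mk_surjective y
    obtain ⟨c, hc⟩ := hres a
    exact ⟨c, hge (Ideal.mem_map_of_mem (Ideal.Quotient.mk b) hc)⟩
  · rw [eq_bot_iff]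
    refine (Ideal.pow_right_mono hle 4).trans ?_
    rw [← Ideal.map_pow, Ideal.map_le_iff_le_comap, ← RingHom.ker_eq_comap_bot, Ideal.mk_ker]
    exact hb

variable {n : ℕ} {Φ : MvPowerSeries (Fin n) k →ₐ[k] R}

/-- The universal derivation of `R / 𝔟` factors through Ω by a linear map that kills `xΩ + R dx`,
since `x` is zero in `R / 𝔟`. -/
theorem exists_mk_eq_algebraMap_of_derivation_eq [CharZero k]
    (hres : ∀ r : R, ∃ c : k, r - algebraMap k R c ∈ maximalIdeal R)
    (hX : ∀ i, Φ (X i) ∈ maximalIdeal R) (hΦ : Function.Surjective Φ)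
    {d : Derivation k R (UniversallyFiniteDifferentials Φ)}
    (hd : ∀ f, d (Φ f) = Submodule.Quotient.mk (jacobianColumn Φ f))
    {x : R} {b : Ideal R} (hxb : x ∈ b) (hb : maximalIdeal R ^ 4 ≤ b) [Module.Finite k (R ⧸ b)]
    {r a : R} {ω : UniversallyFiniteDifferentials Φ} (h : d r = x • ω + a • d x) :
    ∃ c : k, Ideal.Quotient.mk b r = algebraMap k (R ⧸ b) c := by
  have : Module.Finite k (Ω[(R ⧸ b)⁄k]) := Module.Finite.trans (R ⧸ b) _
  have : Module.Finite R (Ω[(R ⧸ b)⁄k]) := Module.Finite.of_restrictScalars_finite k R _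
  let δ : Derivation k R (Ω[(R ⧸ b)⁄k]) := (KaehlerDifferential.D k (R ⧸ b)).compAlgebraMap R
  have hδ : ∀ a, δ a = KaehlerDifferential.D k (R ⧸ b) (Ideal.Quotient.mk b a) := fun _ => rfl
  obtain ⟨L, hL⟩ := exists_linearMap_comp_derivation hX hΦ hd δ
  have hx0 : Ideal.Quotient.mk b x = 0 := Ideal.Quotient.eq_zero_iff_mem.2 hxb
  have h2 : x • L ω = 0 := by
    rw [← algebraMap_smul (R ⧸ b) x, Ideal.Quotient.algebraMap_eq, hx0, zero_smul]
  have hDr : δ r = 0 := by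
    rw [← hL, h, map_add, map_smul, map_smul, hL, hδ x, hx0, map_zero, smul_zero, add_zero, h2]
  exact exists_sub_algebraMap_mem_of_D_mk_eq_zero hres hb hDr

/-- If `x ∈ 𝔟` and `𝔪 ^ 4 ⊆ 𝔟`, then
`dim Ω / (x Ω + R dx) ≥ (n - 1 choose 2) + dim R / 𝔟 - 1`. -/
theorem choose_add_finrank_le [CharZero k]
    (hres : ∀ r : R, ∃ c : k, r - algebraMap k R c ∈ maximalIdeal R)
    (hX : ∀ i, Φ (X i) ∈ maximalIdeal R)
    (hn : (maximalIdeal R).spanFinrank = n) (hΦ : Function.Surjective Φ)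
    {d : Derivation k R (UniversallyFiniteDifferentials Φ)}
    (hd : ∀ f, d (Φ f) = Submodule.Quotient.mk (jacobianColumn Φ f))
    {x : R} (hx : x ∈ maximalIdeal R) {b : Ideal R} (hxb : x ∈ b) (hb : maximalIdeal R ^ 4 ≤ b)
    [Module.Finite k (R ⧸ b)]
    [Module.Finite k (UniversallyFiniteDifferentials Φ ⧸ Submodule.span R {d x})] :
    (n - 1).choose 2 + (Module.finrank k (R ⧸ b) - 1) ≤
      Module.finrank k ((UniversallyFiniteDifferentials Φ ⧸ Submodule.span R {d x}) ⧸
        LinearMap.range (smulₗ k (UniversallyFiniteDifferentials Φ ⧸ Submodule.span R {d x}) x)) := by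
  obtain ⟨π, hπ⟩ := exists_linearPart Φ hX hn hΦ
  obtain ⟨ψ₀, hψ₀⟩ := exists_exteriorDerivative hπ hΦ hd
  have hπsurj : Function.Surjective π := by
    intro c
    refine ⟨∑ i, c i • Φ (X i), ?_⟩
    classical
    ext j
    simp [linearPart_X hπ, Pi.single_apply]
  have hπ1 : π 1 = 0 := by
    ext i
    classical
    rw [← map_one Φ, hπ, MvPowerSeries.coeff_one, if_neg (by simp)]
    rfl
  have hπx : ∀ a, ∃ c : k, π (x * a) = c • π x := by
    intro a
    obtain ⟨ξ, hξ⟩ := hΦ x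
    obtain ⟨g, rfl⟩ := hΦ a
    refine ⟨constantCoeff g, ?_⟩
    rw [← hξ, linearPart_mul hπ, (constantCoeff_eq_zero_iff Φ hX ξ).2 (hξ ▸ hx), zero_smul,
      zero_add]
  obtain ⟨ψ, hψ, hψd, hψx⟩ := exists_exteriorDerivative_quotient d (y := fun i => Φ (X i))
    (fun ω => by
      obtain ⟨a, rfl⟩ := Submodule.Quotient.mk_surjective _ ω
      exact ⟨a, mk_eq_sum_smul hd a⟩) hπsurj hπ1 hψ₀ hπx
    (Submodule.mkQ_surjective (Submodule.span k {π x}))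
    ((Submodule.Quotient.mk_eq_zero _).2 (Submodule.mem_span_singleton_self _))
  -- Constants are divided out because they are the only classes in `R / 𝔟` whose differential can
  -- vanish.
  let q : R →ₗ[k] (R ⧸ b) ⧸ Submodule.span k {(1 : R ⧸ b)} :=
    (Submodule.span k {(1 : R ⧸ b)}).mkQ ∘ₗ (Ideal.Quotient.mkₐ k b).toLinearMap
  have hq : Function.Surjective q :=
    (Submodule.mkQ_surjective _).comp Ideal.Quotient.mk_surjective
  have hmain := finrank_add_finrank_le_finrank_coker_smul d hψ hψd hψx hq fun r a ω h => by
    obtain ⟨c, hc⟩ := exists_mk_eq_algebraMap_of_derivation_eq hres hX hΦ hd hxb hb h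
    refine (Submodule.Quotient.mk_eq_zero _).2 (Submodule.mem_span_singleton.2 ⟨c, ?_⟩)
    rw [← Algebra.algebraMap_eq_smul_one, ← hc]
    rfl
  have h1 := finrank_sub_one_le_finrank_quotient_span_singleton (k := k) (π x)
  rw [Module.finrank_fin_fun] at h1
  rw [exteriorPower.finrank_eq] at hmain
  exact (add_le_add (Nat.choose_le_choose 2 h1)
    (finrank_sub_one_le_finrank_quotient_span_singleton 1)).trans hmain

end LowerBound

/-! ### Comparison of the bounds and conclusion -/

theorem two_mul_choose_two (m : ℕ) : 2 * (m.choose 2 : ℤ) = m * (m - 1) := by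
  induction m with
  | zero => simp
  | succ m ih =>
    rw [Nat.choose_succ_succ' m 1, Nat.choose_one_right]
    push_cast
    linarith

theorem finrank_map_add_finrank_quotient {k R : Type*} [Field k] [CommRing R] [Algebra k R]
    {a b : Ideal R} (hab : a ≤ b) [Module.Finite k (R ⧸ a)] :
    Module.finrank k (b.map (Ideal.Quotient.mk a)) + Module.finrank k (R ⧸ b) =
      Module.finrank k (R ⧸ a) := by
  have h := Submodule.finrank_quotient_add_finrank
    ((b.map (Ideal.Quotient.mk a)).restrictScalars k)
  have e : ((R ⧸ a) ⧸ b.map (Ideal.Quotient.mk a)) ≃ₐ[k] R ⧸ b :=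
    DoubleQuot.quotQuotEquivQuotOfLEₐ k hab
  rw [← e.toLinearEquiv.finrank_eq, add_comm]
  exact h

theorem finite_quotient_of_le {k R : Type*} [Field k] [CommRing R] [Algebra k R]
    {a b : Ideal R} (hab : a ≤ b) [Module.Finite k (R ⧸ a)] : Module.Finite k (R ⧸ b) :=
  Module.Finite.of_surjective (Ideal.Quotient.factorₐ k hab).toLinearMap
    (Ideal.Quotient.factor_surjective hab)

/-- If the universally finite differentials are torsion-free, then every ideal `𝔟` containing `x`
and `𝔪 ^ 4` satisfies `(n - 1 choose 2) ≤ dim 𝔟 / (x)`. -/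
theorem choose_le_finrank_of_torsion_eq_bot {k : Type*} [Field k] [CharZero k]
    {R : Type*} [CommRing R] [IsDomain R] [IsLocalRing R] [IsNoetherianRing R] [Algebra k R]
    [IsAdicComplete (maximalIdeal R) R]
    (hres : ∀ r : R, ∃ c : k, r - algebraMap k R c ∈ maximalIdeal R)
    (hdim : ringKrullDim R = 1) {n : ℕ} (hn : (maximalIdeal R).spanFinrank = n)
    {x : R} (hx : IsReductionOf (Ideal.span {x}) (maximalIdeal R))
    {b : Ideal R} (hxb : x ∈ b) (hb : maximalIdeal R ^ 4 ≤ b)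
    {Φ : MvPowerSeries (Fin n) k →ₐ[k] R} (hΦ : Function.Surjective Φ)
    (htors : Submodule.torsion R (UniversallyFiniteDifferentials Φ) = ⊥) :
    (n - 1).choose 2 ≤ Module.finrank k (b.map (Ideal.Quotient.mk (Ideal.span {x}))) := by
  have hX := map_X_mem_maximalIdeal Φ hres
  have hxm : x ∈ maximalIdeal R := hx.1 (Ideal.mem_span_singleton_self x)
  have hx2 := hx.notMem_maximalIdeal_sq hdim
  have hx0 : x ≠ 0 := by
    rintro rfl
    exact hx2 (Ideal.zero_mem _)
  have hfin : Module.Finite k (R ⧸ Ideal.span {x}) := hx.finite_quotient hres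
  have hle : Ideal.span {x} ≤ b := (Ideal.span_singleton_le_iff_mem _).2 hxb
  have hfinb : Module.Finite k (R ⧸ b) := finite_quotient_of_le hle
  obtain ⟨d, hd⟩ := exists_universalDerivation Φ hΦ
  have : Module.IsTorsionFree R (UniversallyFiniteDifferentials Φ) :=
    Submodule.isTorsionFree_iff_torsion_eq_bot.2 htors
  obtain ⟨N, hN⟩ := exists_maximalIdeal_pow_smul_eq_zero hdim (quotient_isTorsion hd hxm)
  have hfinY : Module.Finite k (UniversallyFiniteDifferentials Φ ⧸ Submodule.span R {d x}) :=
    finite_of_pow_maximalIdeal_smul_eq_zero hres hN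
  have hupper := finrank_coker_smul_lt (k := k) hx0
    (fun ω => derivation_ne_smul hX hn hΦ hd hxm hx2 ω)
  have hlower := choose_add_finrank_le hres hX hn hΦ hd hxm hxb hb
  have hcount := finrank_map_add_finrank_quotient (k := k) hle
  -- The truncated `dim R / 𝔟 - 1` does no harm: if `𝔟 = R`, the strict upper bound alone gives the
  -- claim.
  omega

theorem mainTheorem1 (k : Type*) [Field k] [IsAlgClosed k] [CharZero k]
    (R : Type*) [CommRing R] [IsDomain R] [IsLocalRing R] [IsNoetherianRing R] [Algebra k R]
    [IsAdicComplete (maximalIdeal R) R]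
    (hres : Function.Bijective (algebraMap k (ResidueField R)))
    (hdim : ringKrullDim R = 1)
    (n : ℕ) (hn : (maximalIdeal R).spanFinrank = n)
    (x : R) (hx : IsMinimalReductionOf (Ideal.span {x}) (maximalIdeal R))
    (hm : maximalIdeal R ^ 4 ≤ conductorIdeal R ⊔ Ideal.span {x})
    (hs : 2 * (reducedType k R x : ℤ) ≤ (n : ℤ) * ((n : ℤ) - 3))
    (Φ : MvPowerSeries (Fin n) k →ₐ[k] R) (hΦ : Function.Surjective Φ) :
    Submodule.torsion R (UniversallyFiniteDifferentials Φ) ≠ ⊥ ∧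
      (IsRegularLocalRing R ↔ Submodule.torsion R (UniversallyFiniteDifferentials Φ) = ⊥) := by
  have hres' : ∀ r : R, ∃ c : k, r - algebraMap k R c ∈ maximalIdeal R := by
    intro r
    obtain ⟨c, hc⟩ := hres.2 (residue R r)
    refine ⟨c, ?_⟩
    rw [← residue_eq_zero_iff, map_sub, ← hc]
    exact sub_self _
  have hn0 : n ≠ 0 := by
    rintro rfl
    have hbot : maximalIdeal R = ⊥ :=
      (Submodule.spanFinrank_eq_zero_iff_eq_bot (IsNoetherian.noetherian _)).1 hn
    have := ringKrullDim_eq_zero_of_isField (isField_iff_maximalIdeal_eq.2 hbot)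
    rw [hdim] at this
    exact one_ne_zero this
  have htors : Submodule.torsion R (UniversallyFiniteDifferentials Φ) ≠ ⊥ := by
    intro htors
    have h : (n - 1).choose 2 ≤ reducedType k R x :=
      choose_le_finrank_of_torsion_eq_bot hres' hdim hn hx.prop
        (Ideal.mem_sup_right (Ideal.mem_span_singleton_self x)) hm hΦ htors
    -- With `m = n - 1`, `m (m - 1) = n (n - 3) + 2`, which exceeds twice the reduced type by at
    -- least 2.
    obtain ⟨m, rfl⟩ := Nat.exists_eq_succ_of_ne_zero hn0
    have h2 := two_mul_choose_two m
    have h6 : ((m.choose 2 : ℕ) : ℤ) ≤ reducedType k R x := by exact_mod_cast h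
    push_cast at hs
    nlinarith
  refine ⟨htors, fun hreg => ?_, fun h => absurd h htors⟩
  -- A regular `R` has `n = 1`, where `n (n - 3) = -2` cannot bound twice a natural number.
  exfalso
  have h1 := (isRegularLocalRing_iff R).1 hreg
  rw [hdim, hn] at h1
  have h2 : n = 1 := by exact_mod_cast h1
  subst h2
  norm_num at hs
  have : (0 : ℤ) ≤ reducedType k R x := Int.natCast_nonneg _
  linarith
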